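/- Let $\Bbbk$ be an algebraically closed field of characteristic zero; varieties are integral separated schemes of finite type over $\Bbbk$, and points are closed points. Let $r,w\in\mathbb{N}_+$, and let $\mathbb{G}_a^r\rtimes_w\mathbb{G}_m$ be the semi-direct product in which $\mathbb{G}_m$ acts on $\mathfrak u:=\mathrm{Lie}(\mathbb{G}_a^r)$ by scalar multiplication with weight $w$. **Situation.** $\pi:C\to S$ is an affine cone of varieties, i.e. an affine morphism of varieties with a grading $\mathcal A:=\pi_*\mathcal O_C=\bigoplus_{n\ge 0}\mathcal A_n$ by quasi-coherent $\mathcal{O}_S$-modules such that $\mathcal A_0=\mathcal O_S$; equivalently $\mathbb{G}_m$ acts on $C$ over $S$, with $t$ multiplying functions in $\mathcal A_n$ by $t^n$. The group $\mathbb{G}_a^r$ acts on $C$ such that $\pi$ is invariant, and the two actions form an action of $\mathbb{G}_a^r\rtimes_w\mathbb{G}_m$. Let $Z=\mathbb V(\bigoplus_{n>0}\mathcal A_n)\subseteq C$ be the zero section. **Index.** For $x\in C$ let $\mathrm{Stab}_{\mathfrak u}(x)\subseteq\mathfrak u$ be the subspace of those $\xi$ whose vector field on $C$ vanishes at $x$.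 Let $\mathcal Q(\pi)$ be the cokernel of the morphism $\Omega_{\mathcal A/\mathcal A_0}\to\mathfrak u^*\otimes\mathcal A$, $\mathrm df\mapsto(\xi\mapsto\xi.f)$, and let $\mathrm{Fit}_j(\mathcal Q(\pi))\subseteq\mathcal A$ be its Fitting ideals ($\mathrm{Fit}_{-1}=0$). Put $$d(\pi):=\min_{z\in Z}\dim\mathrm{Stab}_{\mathfrak u}(z),\qquad e(\pi):=\min\{n\in\mathbb N:\mathrm{Fit}_{d(\pi)-1}(\mathcal Q(\pi))\cap\mathcal A_n\neq0\},$$ with $e(\pi):=\infty$ if $\mathrm{Fit}_{d(\pi)-1}(\mathcal Q(\pi))=0$. Thus $(d(\pi),e(\pi))\in\mathbb N\times\overline{\mathbb N_+}$, where $\overline{\mathbb N_+}=\mathbb N_+\sqcup\{\infty\}$, and $\mathbb N\times\overline{\mathbb N_+}$ is ordered lexicographically. **Modification.** Let $V\subsetneq C$ be a $\mathbb{G}_a^r\rtimes_w\mathbb{G}_m$-invariant closed subscheme, and $\mathrm{Bl}_V(C)\to C$ the blowing up with the induced $\mathbb{G}_m$-action. The modification of $\pi$ along $V$ is $\pi':C'\to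 S'$, where $C'\subseteq\mathrm{Bl}_V(C)$ is the open stratum of the Białynicki-Birula stratification (the non-empty open subset consisting of the points $x$ whose limit $\lim_{t\to0}t.x$ lies in a certain connected component of the fixed locus), and $\pi':C'\to S'$ is an affine cone of varieties with a $\mathbb{G}_a^r\rtimes_w\mathbb{G}_m$-action as in the Situation, lying over a morphism $S'\to S$ such that $C'\to C$ is $\mathbb{G}_a^r\rtimes_w\mathbb{G}_m$-equivariant. **Proposition.** Let $\mathbb{G}_a^r\rtimes_w\mathbb{G}_m$ act on $\pi:C\to S$ as in the Situation. Assume that $\dim\mathrm{Stab}_{\mathfrak u}(z)=d(\pi)$ for all $z\in Z$ and that $e(\pi)<\infty$. Let $\pi':C'\to S'$ be the modification of $\pi$ along $\mathbb{G}_a^r.Z$, the scheme-theoretic image of $\mathbb{G}_a^r\times Z\to C$, $(u,z)\mapsto u.z$. Then $$(d(\pi'),e(\pi'))<(d(\pi),e(\pi))\quad\text{in }\mathbb N\times\overline{\mathbb N_+}.$$ -/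

import Mathlib

open CategoryTheory AlgebraicGeometry

universe u

noncomputable section

/-! ### Actions of `𝔾ₐʳ` on affine schemes and the module `Q` -/

/-- A `𝔾ₐʳ`-action on `Spec A` over `Spec A₀`, as a co-action `A → A[u₁, …, uᵣ] = 𝒪(𝔾ₐʳ) ⊗ A`:
the function `σ f` is `(u, x) ↦ f (u.x)`.  Being `A₀`-linear means that `Spec A → Spec A₀` is
invariant. -/
structure GaCoaction (r : ℕ) (A₀ A : Type u) [CommRing A₀] [CommRing A] [Algebra A₀ A] where
  /-- the co-action map -/
  σ : A →ₐ[A₀] MvPolynomial (Fin r) A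
  /-- `0.x = x` -/
  counit : ∀ f : A, MvPolynomial.constantCoeff (σ f) = f
  /-- `u.(v.x) = (u + v).x`, as an identity in `A[u][v]` -/
  coassoc : ∀ f : A,
    MvPolynomial.map σ.toRingHom (σ f) =
      MvPolynomial.eval₂ (MvPolynomial.C.comp MvPolynomial.C)
        (fun i => MvPolynomial.X i + MvPolynomial.C (MvPolynomial.X i)) (σ f)

namespace GaCoaction

variable {r : ℕ} {A₀ A : Type u} [CommRing A₀] [CommRing A] [Algebra A₀ A]
  (a : GaCoaction r A₀ A)

/-- The vector fields on `Spec A` given by the standard basis of the Lie algebra of `𝔾ₐʳ`: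
`ξᵢ f = (∂/∂uᵢ) (σ f)` at `u = 0`. Together they form a derivation `A → 𝔲* ⊗ A = Aʳ`. -/
def vectorFields : Derivation A₀ A (Fin r → A) :=
  Derivation.mk'
    { toFun := fun f i => MvPolynomial.constantCoeff (MvPolynomial.pderiv i (a.σ f))
      map_add' := fun f g => by ext i; simp
      map_smul' := fun c f => by
        ext i
        rw [map_smul, ← algebraMap_smul A c (a.σ f), Derivation.map_smul]
        simp [Algebra.smul_def] }
    (fun f g => by
      ext i
      simp [Derivation.leibniz, a.counit])

/-- The morphism `Ω_{A/A₀} → 𝔲* ⊗ A`. -/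
def conormalMap : Ω[A⁄A₀] →ₗ[A] (Fin r → A) := a.vectorFields.liftKaehlerDifferential

/-- `Q = coker (Ω_{A/A₀} → 𝔲* ⊗ A)`. -/
abbrev Q : Type u := (Fin r → A) ⧸ LinearMap.range a.conormalMap

/-- The ideal of the scheme theoretic image of `𝔾ₐʳ × V(I) → Spec A`, i.e. the kernel of
`A → (A/I)[u₁, …, uᵣ]`. -/
def sweepIdeal (I : Ideal A) : Ideal A :=
  RingHom.ker ((MvPolynomial.map (Ideal.Quotient.mk I)).comp a.σ.toRingHom)

end GaCoaction

/-- The `j`-th Fitting ideal of a module `M` with `n` generators, given by a surjection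
`q : Rⁿ → M`: it is generated by the `(n - j) × (n - j)`-minors of the matrices whose rows
are relations, i.e. elements of `ker q`. It is `0` for `j < 0` and `R` for `j ≥ n`. -/
def fittingIdeal {R M : Type u} [CommRing R] [AddCommGroup M] [Module R M] {n : ℕ}
    (q : (Fin n → R) →ₗ[R] M) (j : ℤ) : Ideal R :=
  Ideal.span {m | ∃ (rel : Fin ((n : ℤ) - j).toNat → LinearMap.ker q)
    (col : Fin ((n : ℤ) - j).toNat → Fin n),
      m = (Matrix.of fun s t => (rel s : Fin n → R) (col t)).det}

/-! ### Affine cones with an action of `𝔾ₐʳ ⋊_w 𝔾ₘ` -/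

/-- The ring of functions on `π⁻¹(U)` is an algebra over the ring of functions on `U`. -/
instance preimageSectionsAlgebra {C S : Scheme.{u}} (π : C ⟶ S) (U : S.Opens) :
    Algebra Γ(S, U) Γ(C, π ⁻¹ᵁ U) :=
  (π.app U).hom.toAlgebra

/-- Restriction of functions from `π⁻¹(U)` to `π⁻¹(V)` for `V ⊆ U`. -/
def preimageRes {C S : Scheme.{u}} (π : C ⟶ S) {V U : S.Opens} (h : V ≤ U) :
    Γ(C, π ⁻¹ᵁ U) →+* Γ(C, π ⁻¹ᵁ V) :=
  (C.presheaf.map (homOfLE (π.preimage_mono h)).op).hom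

/-- The constant functions on an open subset of a scheme over a field. -/
def scalar {k : Type u} [Field k] {Y : Scheme.{u}} (s : Y ⟶ Spec (.of k)) (V : Y.Opens) :
    k →+* Γ(Y, V) :=
  (s.appLE ⊤ V le_top).hom.comp (Scheme.ΓSpecIso (.of k)).inv.hom

/-- An affine cone of varieties `π : C → S` over `k` together with an action of
`𝔾ₐʳ ⋊_w 𝔾ₘ` on `C` such that `π` is `𝔾ₐʳ`-invariant and the `𝔾ₘ`-action is the one given by
the cone structure (`t` multiplies functions of degree `n` by `tⁿ`). -/
structure GradedCone (k : Type u) [Field k] (r w : ℕ) where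
  /-- the total space -/
  C : Scheme.{u}
  /-- the base -/
  S : Scheme.{u}
  /-- the projection -/
  π : C ⟶ S
  /-- the structure morphism of the base -/
  str : S ⟶ Spec (.of k)
  integral_C : IsIntegral C
  integral_S : IsIntegral S
  separated_S : IsSeparated str
  quasiCompact_S : QuasiCompact str
  finiteType_S : LocallyOfFiniteType str
  finiteType_C : LocallyOfFiniteType (π ≫ str)
  affine_π : IsAffineHom π
  /-- the homogeneous parts `𝒜ₙ` of `𝒜 = π_* 𝒪_C`, on affine open subsets of `S` -/
  𝒜 : (U : S.affineOpens) → ℕ → AddSubgroup Γ(C, π ⁻¹ᵁ U.1)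
  graded : ∀ U, SetLike.GradedMonoid (𝒜 U)
  decomposition : ∀ U, DirectSum.IsInternal (𝒜 U)
  /-- `𝒜₀ = 𝒪_S` -/
  injective_app : ∀ U : S.affineOpens, Function.Injective (π.app U.1).hom
  mem_zero_iff : ∀ (U : S.affineOpens) (f : Γ(C, π ⁻¹ᵁ U.1)),
    f ∈ 𝒜 U 0 ↔ f ∈ (π.app U.1).hom.range
  res_mem : ∀ (U V : S.affineOpens) (h : V.1 ≤ U.1) (n : ℕ), ∀ f ∈ 𝒜 U n,
    preimageRes π h f ∈ 𝒜 V n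
  /-- the action of `𝔾ₐʳ` on `C` over `S` -/
  coaction : (U : S.affineOpens) → GaCoaction r Γ(S, U.1) Γ(C, π ⁻¹ᵁ U.1)
  coaction_res : ∀ (U V : S.affineOpens) (h : V.1 ≤ U.1) (f : Γ(C, π ⁻¹ᵁ U.1)),
    (coaction V).σ (preimageRes π h f) = MvPolynomial.map (preimageRes π h) ((coaction U).σ f)
  /-- The actions of `𝔾ₐʳ` and `𝔾ₘ` form an action of `𝔾ₐʳ ⋊_w 𝔾ₘ`, that is
  `t.(u.x) = (tʷu).(t.x)`: the co-action is homogeneous when the coordinates of `𝔾ₐʳ` are given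
  the degree `w`. -/
  coeff_mem : ∀ (U : S.affineOpens) (n : ℕ), ∀ f ∈ 𝒜 U n, ∀ m : Fin r →₀ ℕ,
    (∀ j, j + w * m.degree = n → MvPolynomial.coeff m ((coaction U).σ f) ∈ 𝒜 U j) ∧
      (n < w * m.degree → MvPolynomial.coeff m ((coaction U).σ f) = 0)

namespace GradedCone

variable {k : Type u} [Field k] {r w : ℕ} (X : GradedCone k r w)

/-- The Lie algebra stabiliser of a point `x` in `𝔲 = kʳ`: those `∑ cᵢ ξᵢ` whose vector field
vanishes at `x`. -/
def stab (x : X.C) : Submodule k (Fin r → k) where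
  carrier := {c | ∀ (U : X.S.affineOpens) (hx : x ∈ X.π ⁻¹ᵁ U.1) (f : Γ(X.C, X.π ⁻¹ᵁ U.1)),
    X.C.evaluation (X.π ⁻¹ᵁ U.1) x hx
      (∑ i, scalar (X.π ≫ X.str) _ (c i) * (X.coaction U).vectorFields f i) = 0}
  zero_mem' := fun U hx f => by simp
  add_mem' := fun {a b} ha hb U hx f => by
    simpa [add_mul, Finset.sum_add_distrib, ha U hx f] using
      (congrArg₂ (· + ·) (ha U hx f) (hb U hx f))
  smul_mem' := fun c a ha U hx f => by
    have h := congrArg (X.C.evaluation (X.π ⁻¹ᵁ U.1) x hx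
      (scalar (X.π ≫ X.str) _ c) * ·) (ha U hx f)
    simpa [mul_assoc, ← Finset.mul_sum] using h

/-- The closed points of the zero section `Z = V(⨁_{n > 0} 𝒜ₙ)`. -/
def zeroSection : Set X.C :=
  {z | IsClosed {z} ∧ ∀ (U : X.S.affineOpens) (hz : z ∈ X.π ⁻¹ᵁ U.1) (n : ℕ), 0 < n →
    ∀ f ∈ X.𝒜 U n, X.C.evaluation (X.π ⁻¹ᵁ U.1) z hz f = 0}

/-- The ideal `𝒜_{>0}` of the zero section. -/
def irrelevantIdeal (U : X.S.affineOpens) : Ideal Γ(X.C, X.π ⁻¹ᵁ U.1) :=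
  Ideal.span (⋃ n > 0, (X.𝒜 U n : Set Γ(X.C, X.π ⁻¹ᵁ U.1)))

/-- `d(π)`, the minimum of `dim Stab_𝔲 (z)` for `z ∈ Z`. -/
def d : ℕ := sInf ((fun z => Module.finrank k (X.stab z)) '' X.zeroSection)

/-- The Fitting ideal `Fit_j (Q(π))` over an affine open subset of `S`. -/
def fit (j : ℤ) (U : X.S.affineOpens) : Ideal Γ(X.C, X.π ⁻¹ᵁ U.1) :=
  fittingIdeal (M := (X.coaction U).Q) (Submodule.mkQ _) j

/-- `e(π)`, the smallest `n` with `Fit_{d(π)-1} (Q(π)) ∩ 𝒜ₙ ≠ 0`, or `∞`. -/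
def e : ℕ∞ :=
  sInf ((fun n : ℕ => (n : ℕ∞)) ''
    {n | ∃ U : X.S.affineOpens, ∃ f ∈ X.fit ((X.d : ℤ) - 1) U, f ∈ X.𝒜 U n ∧ f ≠ 0})

/-- The index `(d(π), e(π))` in `ℕ × (ℕ₊ ∪ {∞})` with the lexicographic order. -/
def index : ℕ ×ₗ ℕ∞ := toLex (X.d, X.e)

/-- The ideal of the centre `𝔾ₐʳ.Z`, the scheme theoretic image of `𝔾ₐʳ × Z → C`. -/
def centre (U : X.S.affineOpens) : Ideal Γ(X.C, X.π ⁻¹ᵁ U.1) :=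
  (X.coaction U).sweepIdeal (X.irrelevantIdeal U)

/-! ### Blowing up -/

/-- For a sheaf of ideals `J` on `C`, given on the open subsets `π⁻¹(U)`, and a morphism
`f : T → C`: the inverse image ideal `f⁻¹J · 𝒪_T` is the ideal of an effective Cartier divisor. -/
def PullsBackToCartier (J : (U : X.S.affineOpens) → Ideal Γ(X.C, X.π ⁻¹ᵁ U.1))
    {T : Scheme.{u}} (f : T ⟶ X.C) : Prop :=
  ∀ (U : X.S.affineOpens) (t : T), t ∈ f ⁻¹ᵁ X.π ⁻¹ᵁ U.1 →
    ∃ (W : T.affineOpens) (h : W.1 ≤ f ⁻¹ᵁ X.π ⁻¹ᵁ U.1), t ∈ W.1 ∧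
      ∃ g ∈ nonZeroDivisors Γ(T, W.1),
        (J U).map (f.appLE (X.π ⁻¹ᵁ U.1) W.1 h).hom = Ideal.span {g}

/-- `b : B → C` is the blowing up of `C` along the ideal `J`, by its universal property. -/
structure IsBlowup (J : (U : X.S.affineOpens) → Ideal Γ(X.C, X.π ⁻¹ᵁ U.1))
    {B : Scheme.{u}} (b : B ⟶ X.C) : Prop where
  cartier : X.PullsBackToCartier J b
  lift : ∀ {T : Scheme.{u}} (f : T ⟶ X.C), X.PullsBackToCartier J f → ∃! g : T ⟶ B, g ≫ b = f

end GradedCone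

/-! ### Limits and the Białynicki-Birula stratification -/

section BialynickiBirula

variable {k : Type u} [Field k] {B : Scheme.{u}} (s : B ⟶ Spec (.of k))
  (φ : kˣ → (B ⟶ B))

/-- The closed point `t` of the affine line. -/
def linePoint (t : k) : Spec (.of (Polynomial k)) :=
  Spec.map (CommRingCat.ofHom (Polynomial.evalRingHom t)) (IsLocalRing.closedPoint k)

/-- `lim_{t → 0} t.x = y` for `𝔾ₘ` acting through `φ`: the orbit map `t ↦ t.x` extends to a
morphism from the affine line that sends `0` to `y`. -/
def HasLimit (x y : B) : Prop :=
  ∃ ℓ : Spec (.of (Polynomial k)) ⟶ B,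
    ℓ ≫ s = Spec.map (CommRingCat.ofHom Polynomial.C) ∧
      (∀ t : kˣ, ℓ (linePoint (t : k)) = φ t x) ∧ ℓ (linePoint 0) = y

/-- The closed fixed points of `𝔾ₘ`. -/
def fixedPoints : Set B := {x | IsClosed {x} ∧ ∀ t, φ t x = x}

/-- The open subset `V` is the open stratum of the Białynicki-Birula stratification: it is
non-empty and its closed points are those whose limit lies in one fixed connected component of the
fixed locus. -/
def IsOpenStratum (V : B.Opens) : Prop :=
  (V : Set B).Nonempty ∧ ∃ x₀ ∈ fixedPoints φ, ∀ x : B, IsClosed {x} →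
    (x ∈ V ↔ ∃ y ∈ connectedComponentIn (fixedPoints φ) x₀, HasLimit s φ x y)

end BialynickiBirula

/-! ### Modifications -/

namespace GradedCone

variable {k : Type u} [Field k] {r w : ℕ}

/-- `X'` is the modification of `X` along the closed subscheme with ideal `J`: with
`b : B → C` the blowing up along `J`, the total space `C'` of `X'` is the open stratum of the
Białynicki-Birula stratification of `B`, and the morphism `C' → C` is equivariant for
`𝔾ₐʳ ⋊_w 𝔾ₘ`. -/
structure Modification (X : GradedCone k r w)
    (J : (U : X.S.affineOpens) → Ideal Γ(X.C, X.π ⁻¹ᵁ U.1)) (X' : GradedCone k r w) where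
  /-- the blowing up -/
  B : Scheme.{u}
  /-- the blowing up morphism -/
  b : B ⟶ X.C
  isBlowup : X.IsBlowup J b
  /-- the action of `𝔾ₘ` on the blowing up -/
  φ : kˣ → (B ⟶ B)
  /-- `b` is `𝔾ₘ`-equivariant: `b (t.x)` and `b (x)` have the same image in `S`, and
  `f (b (t.x)) = tⁿ f (b (x))` for `f` of degree `n`. By the universal property of
  `b` this determines `φ`. -/
  φ_π : ∀ t, φ t ≫ b ≫ X.π = b ≫ X.π
  φ_smul : ∀ (t : kˣ) (U : X.S.affineOpens) (n : ℕ), ∀ f ∈ X.𝒜 U n,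
    ∀ h : b ⁻¹ᵁ X.π ⁻¹ᵁ U.1 ≤ (φ t ≫ b) ⁻¹ᵁ X.π ⁻¹ᵁ U.1,
      ((φ t ≫ b).appLE (X.π ⁻¹ᵁ U.1) (b ⁻¹ᵁ X.π ⁻¹ᵁ U.1) h).hom f =
        scalar (b ≫ X.π ≫ X.str) _ ((t : k) ^ n) * (b.app (X.π ⁻¹ᵁ U.1)).hom f
  /-- the inclusion of `C'` into the blowing up -/
  ι : X'.C ⟶ B
  isOpenImmersion : IsOpenImmersion ι
  isOpenStratum : IsOpenStratum (b ≫ X.π ≫ X.str) φ ι.opensRange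
  /-- the morphism of the bases -/
  q : X'.S ⟶ X.S
  q_str : q ≫ X.str = X'.str
  comm : X'.π ≫ q = ι ≫ b ≫ X.π
  /-- `p = ι ≫ b : C' → C` is `𝔾ₘ`-equivariant -/
  map_mem : ∀ (U : X.S.affineOpens) (U' : X'.S.affineOpens)
    (h : X'.π ⁻¹ᵁ U'.1 ≤ (ι ≫ b) ⁻¹ᵁ X.π ⁻¹ᵁ U.1), U'.1 ≤ q ⁻¹ᵁ U.1 →
    ∀ (n : ℕ), ∀ f ∈ X.𝒜 U n,
      ((ι ≫ b).appLE (X.π ⁻¹ᵁ U.1) (X'.π ⁻¹ᵁ U'.1) h).hom f ∈ X'.𝒜 U' n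
  /-- `p = ι ≫ b : C' → C` is `𝔾ₐʳ`-equivariant -/
  map_coaction : ∀ (U : X.S.affineOpens) (U' : X'.S.affineOpens)
    (h : X'.π ⁻¹ᵁ U'.1 ≤ (ι ≫ b) ⁻¹ᵁ X.π ⁻¹ᵁ U.1), U'.1 ≤ q ⁻¹ᵁ U.1 →
    ∀ f : Γ(X.C, X.π ⁻¹ᵁ U.1),
      (X'.coaction U').σ (((ι ≫ b).appLE (X.π ⁻¹ᵁ U.1) (X'.π ⁻¹ᵁ U'.1) h).hom f) =
        MvPolynomial.map ((ι ≫ b).appLE (X.π ⁻¹ᵁ U.1) (X'.π ⁻¹ᵁ U'.1) h).hom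
          ((X.coaction U).σ f)

end GradedCone

end

/-! Let J be the ideal of the centre and m = r - d(π). The map C' → C is equivariant, so stabilisers
only shrink along it, and it sends Z' into Z. Since the stabiliser dimension is constant on Z, this
gives d(π') ≤ d(π) (`Modification.d_le`). What remains is to lower e when d stays the same
(`Modification.e_lt`).

Over a non-empty open part of S there are functions s_1, …, s_m of degree w on which m of the
fields, ξ_{c 1}, …, ξ_{c m}, act like ∂/∂s_j (`exists_isSlice`). The transverse fields ρ_i = ξ_i - ∑
ξ_i(s_j) ξ_{c j} kill every s_j. A minor of size m + 1 that borders the identity block equals some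
ρ_i(f), and Fit_{d-1} is generated by these values. Minimality of d forces ρ_i to vanish in degree w
(`transverse_eq_zero`). Integrating along the s_j then shows that each homogeneous function is
congruent modulo J to one killed by all ρ_i (`exists_sub_mem_sweepIdeal`). So a non-zero element of
Fit_{d-1} in degree e yields f ∈ J of degree n + w, with n ≤ e and ρ_i(f) ≠ 0 for some i.

At the generic point of Z' the ideal J becomes principal. A homogeneous g ∈ J generates it, and its
degree δ > 0 is the least degree of a non-zero homogeneous element of J. Hence ρ_i(g), which lies in
J in degree δ - w, is zero. Writing f = y g up to a factor from the base gives ρ_i(f) = g ρ_i(y).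
Thus ρ_i(y) is a non-zero element of Fit_{d-1}(Q(π')) of degree n - δ < e
(`exists_fittingIdeal_degree_lt`). -/

noncomputable section

namespace GaCoaction

/-! ### Vector fields of a co-action and the ideal of the centre. -/

section Fields

variable {r : ℕ} {A₀ A : Type u} [CommRing A₀] [CommRing A] [Algebra A₀ A]
  (a : GaCoaction r A₀ A)

/-- The vector field of the `i`-th basis vector of the Lie algebra. -/
def field (i : Fin r) : Derivation A₀ A A :=
  (LinearMap.proj i : (Fin r → A) →ₗ[A] A).compDer a.vectorFields

theorem vectorFields_apply (f : A) (i : Fin r) : a.vectorFields f i = a.field i f := rfl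

theorem field_apply (i : Fin r) (f : A) :
    a.field i f = MvPolynomial.constantCoeff (MvPolynomial.pderiv i (a.σ f)) := rfl

theorem field_eq_coeff (i : Fin r) (f : A) :
    a.field i f = MvPolynomial.coeff (Finsupp.single i 1) (a.σ f) := by
  rw [field_apply, MvPolynomial.constantCoeff_eq, MvPolynomial.coeff_pderiv]
  simp

/-- Differentiate the identity for `(u + v).x` in `v` at `v = 0`. This is why the fields commute and
preserve the ideal of the centre. -/
theorem σ_field (i : Fin r) (f : A) : a.σ (a.field i f) = MvPolynomial.pderiv i (a.σ f) := by
  -- The expression is `P(u + v)` with `v` the outer variables. Its value at `v = 0` is carried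
  -- along because the product rule for the derivative needs it.
  have key : ∀ P : MvPolynomial (Fin r) A,
      MvPolynomial.constantCoeff (MvPolynomial.eval₂ (MvPolynomial.C.comp MvPolynomial.C)
        (fun i => MvPolynomial.X i + MvPolynomial.C (MvPolynomial.X i)) P :
          MvPolynomial (Fin r) (MvPolynomial (Fin r) A)) = P ∧
      MvPolynomial.constantCoeff (MvPolynomial.pderiv i
        (MvPolynomial.eval₂ (MvPolynomial.C.comp MvPolynomial.C)
        (fun i => MvPolynomial.X i + MvPolynomial.C (MvPolynomial.X i)) P :
          MvPolynomial (Fin r) (MvPolynomial (Fin r) A))) = MvPolynomial.pderiv i P := by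
    intro P
    induction P using MvPolynomial.induction_on with
    | C c => simp
    | add p q hp hq => simp [hp.1, hp.2, hq.1, hq.2]
    | mul_X p j hp =>
      refine ⟨by simp [hp.1], ?_⟩
      simp only [MvPolynomial.eval₂_mul, MvPolynomial.eval₂_X, Derivation.leibniz, map_add,
        smul_eq_mul, map_mul, hp.1, hp.2, MvPolynomial.pderiv_C, MvPolynomial.constantCoeff_X,
        MvPolynomial.constantCoeff_C, zero_add, add_zero]
      by_cases h : i = j
      · subst h; simp
      · rw [MvPolynomial.pderiv_X_of_ne (Ne.symm h), MvPolynomial.pderiv_X_of_ne (Ne.symm h)]; simp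
  have h := congrArg (fun P => MvPolynomial.constantCoeff (MvPolynomial.pderiv i P)) (a.coassoc f)
  simp only [(key (a.σ f)).2, MvPolynomial.pderiv_map, MvPolynomial.constantCoeff_map] at h
  exact h

theorem field_comm (i j : Fin r) (f : A) : a.field i (a.field j f) = a.field j (a.field i f) := by
  rw [a.field_apply i, a.field_apply j (a.field i f), σ_field, σ_field]
  simp only [MvPolynomial.constantCoeff_eq, MvPolynomial.coeff_pderiv]
  by_cases h : i = j
  · subst h; rfl
  · simp [h, Ne.symm h, add_comm]

theorem mem_sweepIdeal {I : Ideal A} {f : A} :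
    f ∈ a.sweepIdeal I ↔ ∀ m, MvPolynomial.coeff m (a.σ f) ∈ I := by
  rw [sweepIdeal, RingHom.mem_ker, MvPolynomial.ext_iff]
  refine forall_congr' fun m => ?_
  simp [MvPolynomial.coeff_map, Ideal.Quotient.eq_zero_iff_mem]

theorem field_mem_sweepIdeal {I : Ideal A} {f : A} (hf : f ∈ a.sweepIdeal I) (i : Fin r) :
    a.field i f ∈ a.sweepIdeal I := by
  rw [mem_sweepIdeal] at hf ⊢
  intro m
  rw [σ_field, MvPolynomial.coeff_pderiv]
  exact I.mul_mem_right _ (hf _)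

/-- Taylor's formula in characteristic zero: if `m i ≠ 0`, the coefficient of `σ f` at `m` is `1 / m
i` times the coefficient of `σ (ξᵢ f)` at `m - eᵢ`. -/
theorem mem_sweepIdeal_of_field [Algebra ℚ A] {I : Ideal A} {f : A} (h0 : f ∈ I)
    (h : ∀ i, a.field i f ∈ a.sweepIdeal I) : f ∈ a.sweepIdeal I := by
  rw [mem_sweepIdeal]
  intro m
  by_cases hm : m = 0
  · subst hm
    rw [← MvPolynomial.constantCoeff_eq, a.counit]
    exact h0
  · obtain ⟨i, hi⟩ := Finsupp.ne_iff.mp hm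
    have hi' : m i ≠ 0 := hi
    have h1 := (a.mem_sweepIdeal.mp (h i)) (m - Finsupp.single i 1)
    rw [σ_field, MvPolynomial.coeff_pderiv, tsub_add_cancel_of_le
      (by rw [Finsupp.single_le_iff]; omega)] at h1
    have h2 := I.mul_mem_left (algebraMap ℚ A (m i : ℚ)⁻¹) h1
    have h3 : (((m - Finsupp.single i 1 : Fin r →₀ ℕ) i : ℕ) : A) + 1 = algebraMap ℚ A (m i : ℚ) := by
      rw [map_natCast]
      have : (m - Finsupp.single i 1 : Fin r →₀ ℕ) i + 1 = m i := by simp; omega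
      rw [← this]; push_cast; rfl
    rw [h3, mul_left_comm, ← map_mul, inv_mul_cancel₀ (by exact_mod_cast hi'), map_one,
      mul_one] at h2
    exact h2

end Fields

/-! ### Homogeneous co-actions. -/

/-- The co-action is homogeneous for the grading `𝒜`, with the coordinates of `𝔾ₐʳ` of degree
`w`, and the degree zero part of `𝒜` is the base ring. -/
structure IsHomogeneous {r : ℕ} {A₀ A : Type u} [CommRing A₀] [CommRing A] [Algebra A₀ A]
    (a : GaCoaction r A₀ A) (w : ℕ) (𝒜 : ℕ → AddSubgroup A) : Prop where
  mem_zero_iff : ∀ f, f ∈ 𝒜 0 ↔ f ∈ (algebraMap A₀ A).range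
  coeff_mem : ∀ n, ∀ f ∈ 𝒜 n, ∀ m : Fin r →₀ ℕ,
    (∀ j, j + w * m.degree = n → MvPolynomial.coeff m (a.σ f) ∈ 𝒜 j) ∧
      (n < w * m.degree → MvPolynomial.coeff m (a.σ f) = 0)

section Homogeneous

open HomogeneousIdeal

variable {r w : ℕ} {A₀ A : Type u} [CommRing A₀] [CommRing A] [Algebra A₀ A]
  {a : GaCoaction r A₀ A} {𝒜 : ℕ → AddSubgroup A} [GradedRing 𝒜] (h : a.IsHomogeneous w 𝒜)

include h

omit [GradedRing 𝒜] in
theorem IsHomogeneous.algebraMap_mem (c : A₀) : algebraMap A₀ A c ∈ 𝒜 0 :=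
  (h.mem_zero_iff _).mpr ⟨c, rfl⟩

theorem IsHomogeneous.smul_mem (c : A₀) {n : ℕ} {f : A} (hf : f ∈ 𝒜 n) : c • f ∈ 𝒜 n := by
  rw [Algebra.smul_def]
  simpa using SetLike.mul_mem_graded (h.algebraMap_mem c) hf

omit [GradedRing 𝒜] in
theorem IsHomogeneous.field_mem {n j : ℕ} {f : A} (hf : f ∈ 𝒜 n) (hj : j + w = n) (i : Fin r) :
    a.field i f ∈ 𝒜 j := by
  rw [field_eq_coeff]
  exact (h.coeff_mem n f hf _).1 j (by simpa using hj)

omit [GradedRing 𝒜] in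
theorem IsHomogeneous.field_eq_zero {n : ℕ} {f : A} (hf : f ∈ 𝒜 n) (hn : n < w) (i : Fin r) :
    a.field i f = 0 := by
  rw [field_eq_coeff]
  exact (h.coeff_mem n f hf _).2 (by simpa using hn)

omit h in
theorem eq_zero_of_mem_irrelevant {f : A} (hf : f ∈ 𝒜 0) (hf' : f ∈ (irrelevant 𝒜).toIdeal) :
    f = 0 := by
  have := (mem_irrelevant_iff 𝒜 f).mp hf'
  rwa [GradedRing.proj_apply, DirectSum.decompose_of_mem_same _ hf] at this

omit h in
theorem eq_zero_of_mem_sweepIdeal {f : A} (hf : f ∈ 𝒜 0)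
    (hf' : f ∈ a.sweepIdeal (irrelevant 𝒜).toIdeal) : f = 0 := by
  refine eq_zero_of_mem_irrelevant hf ?_
  have := a.mem_sweepIdeal.mp hf' 0
  rwa [← MvPolynomial.constantCoeff_eq, a.counit] at this

/-- Away from the degree `w * m.degree`, the `m`-th coefficient vanishes on the zero section. -/
theorem IsHomogeneous.coeff_mem_irrelevant {n : ℕ} {f : A} (hf : f ∈ 𝒜 n) {m : Fin r →₀ ℕ}
    (hm : n ≠ w * m.degree) : MvPolynomial.coeff m (a.σ f) ∈ (irrelevant 𝒜).toIdeal := by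
  rcases lt_or_gt_of_ne hm with hlt | hlt
  · rw [(h.coeff_mem n f hf m).2 hlt]; exact Ideal.zero_mem _
  · exact mem_irrelevant_of_mem 𝒜 (i := n - w * m.degree) (by omega)
      ((h.coeff_mem n f hf m).1 _ (by omega))

/-- Modulo the irrelevant ideal, only the component of degree `w * m.degree` contributes to the
`m`-th coefficient, so the conditions defining the centre separate by degree. -/
theorem IsHomogeneous.component_mem_sweepIdeal {f : A}
    (hf : f ∈ a.sweepIdeal (irrelevant 𝒜).toIdeal) (n : ℕ) :
    (DirectSum.decompose 𝒜 f n : A) ∈ a.sweepIdeal (irrelevant 𝒜).toIdeal := by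
  classical
  rw [mem_sweepIdeal] at hf ⊢
  intro m
  by_cases hn : n = w * m.degree
  · have h1 := hf m
    have h2 : f = (DirectSum.decompose 𝒜 f n : A) +
        ∑ i ∈ (DirectSum.decompose 𝒜 f).support.erase n, (DirectSum.decompose 𝒜 f i : A) := by
      conv_lhs => rw [← DirectSum.sum_support_decompose 𝒜 f]
      by_cases hs : n ∈ (DirectSum.decompose 𝒜 f).support
      · rw [Finset.add_sum_erase _ (fun i => (DirectSum.decompose 𝒜 f i : A)) hs]
      · rw [Finset.erase_eq_of_notMem hs]
        simp only [DFinsupp.mem_support_toFun, ne_eq, not_not] at hs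
        simp [hs]
    rw [h2, map_add, MvPolynomial.coeff_add] at h1
    refine (Ideal.add_mem_iff_left _ ?_).mp h1
    rw [map_sum, MvPolynomial.coeff_sum]
    refine Ideal.sum_mem _ fun i hi => ?_
    exact h.coeff_mem_irrelevant (DirectSum.decompose 𝒜 f i).2
      (hn ▸ (Finset.ne_of_mem_erase hi))
  · exact h.coeff_mem_irrelevant (DirectSum.decompose 𝒜 f n).2 hn

end Homogeneous

end GaCoaction

/-! ### Minors of the vector fields and Fitting ideals. -/

theorem Matrix.det_mul_eq_zero_of_card_lt {R ι n : Type*} [CommRing R] [Fintype ι] [Fintype n]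
    [DecidableEq n] (h : Fintype.card n = Fintype.card ι + 1) (B : Matrix n ι R)
    (S : Matrix ι n R) : (B * S).det = 0 := by
  classical
  let e : n ≃ ι ⊕ Unit := Fintype.equivOfCardEq (by simp [h])
  -- Padding with a zero column and a zero row turns this into a product of square matrices, the
  -- first of which has a zero column.
  have h1 : B * S = (Matrix.fromCols B (0 : Matrix n Unit R)).submatrix id e *
      (Matrix.fromRows S (0 : Matrix Unit n R)).submatrix e id := by
    rw [Matrix.submatrix_mul_equiv, Matrix.fromCols_mul_fromRows]
    simp
  rw [h1, Matrix.det_mul, Matrix.det_eq_zero_of_column_eq_zero (e.symm (Sum.inr ())), zero_mul]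
  intro i
  simp

namespace GaCoaction

open HomogeneousIdeal

section Relations

variable {r : ℕ} {A₀ A : Type u} [CommRing A₀] [CommRing A] [Algebra A₀ A]
  (a : GaCoaction r A₀ A)

theorem range_conormalMap :
    LinearMap.range a.conormalMap = Submodule.span A (Set.range a.vectorFields) := by
  rw [LinearMap.range_eq_map, ← KaehlerDifferential.span_range_derivation, Submodule.map_span,
    ← Set.range_comp]
  congr 1
  ext f
  simp [conormalMap, Derivation.liftKaehlerDifferential_comp_D]

theorem vectorFields_mem_ker (f : A) :
    a.vectorFields f ∈ LinearMap.ker (Submodule.mkQ (LinearMap.range a.conormalMap)) := by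
  rw [Submodule.ker_mkQ, range_conormalMap]
  exact Submodule.subset_span ⟨f, rfl⟩

/-- A minor of the matrix of vector fields lies in the corresponding Fitting ideal of `Q`. -/
theorem det_mem_fittingIdeal {κ : Type*} [Fintype κ] [DecidableEq κ] (j : ℤ)
    (hκ : ((r : ℤ) - j).toNat = Fintype.card κ) (f : κ → A) (c : κ → Fin r) :
    (Matrix.of fun s t => a.field (c t) (f s)).det ∈
      fittingIdeal (M := a.Q) (Submodule.mkQ (LinearMap.range a.conormalMap)) j := by
  let e : Fin ((r : ℤ) - j).toNat ≃ κ := (finCongr hκ).trans (Fintype.equivFin κ).symm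
  refine Ideal.subset_span ⟨fun s => ⟨_, a.vectorFields_mem_ker (f (e s))⟩, fun t => c (e t), ?_⟩
  rw [← Matrix.det_submatrix_equiv_self e]
  rfl

end Relations

/-! ### Slices, transverse fields and integration modulo the centre. -/

section Slice

variable {r w : ℕ} {A₀ A : Type u} [CommRing A₀] [CommRing A] [Algebra A₀ A]
  {a : GaCoaction r A₀ A} {𝒜 : ℕ → AddSubgroup A} {ι : Type*} [Fintype ι] [DecidableEq ι]

/-- Functions `s j` of degree `w` that are linear coordinates for the vector fields
`ξ_{c i}`. -/
structure IsSlice (a : GaCoaction r A₀ A) (w : ℕ) (𝒜 : ℕ → AddSubgroup A)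
    (c : ι → Fin r) (s : ι → A) : Prop where
  mem : ∀ j, s j ∈ 𝒜 w
  field_apply : ∀ i j, a.field (c i) (s j) = if i = j then 1 else 0

/-- The vector field `ξᵢ`, corrected by a combination of the `ξ_{c j}` so that it annihilates the
functions `s j`. -/
def transverse (a : GaCoaction r A₀ A) (c : ι → Fin r) (s : ι → A) (i : Fin r) :
    Derivation A₀ A A :=
  a.field i - ∑ j, a.field i (s j) • a.field (c j)

omit [DecidableEq ι] in
theorem transverse_apply (c : ι → Fin r) (s : ι → A) (i : Fin r) (f : A) :
    a.transverse c s i f = a.field i f - ∑ j, a.field i (s j) * a.field (c j) f := by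
  have h := map_sum (Derivation.coeFnAddMonoidHom (R := A₀) (A := A) (M := A))
    (fun j => a.field i (s j) • a.field (c j)) Finset.univ
  have h' := congrFun h f
  rw [Finset.sum_apply] at h'
  rw [transverse, Derivation.sub_apply]
  exact congrArg _ h'

theorem IsSlice.transverse_slice {c : ι → Fin r} {s : ι → A} (hs : a.IsSlice w 𝒜 c s) (i : Fin r)
    (j : ι) : a.transverse c s i (s j) = 0 := by
  simp [transverse_apply, hs.field_apply]

omit [DecidableEq ι] in
theorem transverse_mem_sweepIdeal (c : ι → Fin r) (s : ι → A) (i : Fin r) {I : Ideal A} {f : A}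
    (hf : f ∈ a.sweepIdeal I) : a.transverse c s i f ∈ a.sweepIdeal I := by
  rw [transverse_apply]
  exact sub_mem (a.field_mem_sweepIdeal hf i)
    (sum_mem fun j _ => Ideal.mul_mem_left _ _ (a.field_mem_sweepIdeal hf _))

theorem IsSlice.transverse_mem [GradedRing 𝒜] (h : a.IsHomogeneous w 𝒜)
    {c : ι → Fin r} {s : ι → A} (hs : a.IsSlice w 𝒜 c s) {n j : ℕ} {f : A}
    (hf : f ∈ 𝒜 n) (hj : j + w = n) (i : Fin r) : a.transverse c s i f ∈ 𝒜 j := by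
  rw [transverse_apply]
  refine sub_mem (h.field_mem hf hj i) (sum_mem fun l _ => ?_)
  simpa using SetLike.mul_mem_graded (h.field_mem (hs.mem l) (zero_add w) i)
    (h.field_mem hf hj (c l))

omit [DecidableEq ι] in
theorem IsHomogeneous.transverse_eq_zero (h : a.IsHomogeneous w 𝒜)
    {c : ι → Fin r} {s : ι → A} {n : ℕ} {f : A}
    (hf : f ∈ 𝒜 n) (hn : n < w) (i : Fin r) : a.transverse c s i f = 0 := by
  simp [transverse_apply, h.field_eq_zero hf hn]

omit [DecidableEq ι] in
/-- If the transverse fields vanish in degree `w`, the centre is cut out by the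
fields `ξ_{c j}`. -/
theorem IsHomogeneous.mem_sweepIdeal_of_field [Algebra ℚ A] [GradedRing 𝒜] (hw : 0 < w)
    (h : a.IsHomogeneous w 𝒜) {c : ι → Fin r} {s : ι → A}
    (hρ : ∀ f ∈ 𝒜 w, ∀ i, a.transverse c s i f = 0) (n : ℕ) :
    ∀ f ∈ 𝒜 n, 0 < n → (∀ j, a.field (c j) f ∈ a.sweepIdeal (irrelevant 𝒜).toIdeal) →
      f ∈ a.sweepIdeal (irrelevant 𝒜).toIdeal := by
  induction n using Nat.strong_induction_on with
  | _ n ih =>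
    intro f hf hn hc
    refine a.mem_sweepIdeal_of_field (mem_irrelevant_of_mem 𝒜 hn hf) fun i => ?_
    -- Only in degree `w` does `ξᵢ f` have degree 0, where the induction hypothesis does not apply;
    -- there `hρ` makes it a combination of the `ξ_{c j} f`.
    rcases lt_trichotomy n w with hlt | heq | hlt
    · rw [h.field_eq_zero hf hlt]; exact Ideal.zero_mem _
    · subst heq
      have h1 := hρ f hf i
      rw [transverse_apply, sub_eq_zero] at h1
      rw [h1]
      exact sum_mem fun j _ => Ideal.mul_mem_left _ _ (hc j)
    · refine ih (n - w) (by omega) _ (h.field_mem hf (by omega) i) (by omega) fun j => ?_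
      rw [field_comm]
      exact a.field_mem_sweepIdeal (hc j) i

/-- A graded Poincaré lemma: the derivatives `ξ_{c j} f` form a closed system, which is integrated
modulo the centre by `(w/n) ∑ s_j g_j`, where `g_j` replaces `ξ_{c j} f` in degree `n - w`. The last
clause is Euler's relation, needed to carry the induction. -/
theorem IsSlice.exists_sub_mem_sweepIdeal [Algebra ℚ A₀] [Algebra ℚ A] [GradedRing 𝒜]
    (hw : 0 < w) (h : a.IsHomogeneous w 𝒜) {c : ι → Fin r} {s : ι → A} (hs : a.IsSlice w 𝒜 c s)
    (hρ : ∀ f ∈ 𝒜 w, ∀ i, a.transverse c s i f = 0) (n : ℕ) :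
    ∀ f ∈ 𝒜 n, ∃ g ∈ 𝒜 n, f - g ∈ a.sweepIdeal (irrelevant 𝒜).toIdeal ∧
      (∀ i, a.transverse c s i g = 0) ∧
      (w : A) * ∑ j, s j * a.field (c j) g = (n : A) * g := by
  induction n using Nat.strong_induction_on with
  | _ n ih =>
    intro f hf
    rcases Nat.eq_zero_or_pos n with rfl | hn
    · have hz : ∀ i, a.field i f = 0 := fun i => h.field_eq_zero hf hw i
      exact ⟨f, hf, by simp, fun i => by simp [transverse_apply, hz], by simp [hz]⟩
    rcases lt_or_ge n w with hlt | hge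
    -- In degrees strictly between 0 and `w` all fields vanish, so `f` itself lies in the ideal of
    -- the centre.
    · refine ⟨0, zero_mem _, ?_, by simp, by simp⟩
      rw [sub_zero]
      refine a.mem_sweepIdeal_of_field (mem_irrelevant_of_mem 𝒜 hn hf) fun i => ?_
      rw [h.field_eq_zero hf hlt]; exact Ideal.zero_mem _
    have hmem : ∀ j, a.field (c j) f ∈ 𝒜 (n - w) := fun j => h.field_mem hf (by omega) _
    choose g hg hgJ hgρ hgE using fun j => ih (n - w) (by omega) _ (hmem j)
    set J := a.sweepIdeal (irrelevant 𝒜).toIdeal with hJ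
    let q : A₀ := algebraMap ℚ A₀ (w / n)
    let G : A := ∑ j, s j * g j
    have hnq : (n : A₀) * q = w := by
      have : ((n : ℚ) * (w / n)) = w := by field_simp
      simpa [q] using congrArg (algebraMap ℚ A₀) this
    have hG : G ∈ 𝒜 n := sum_mem fun j _ => by
      have := SetLike.mul_mem_graded (hs.mem j) (hg j)
      rwa [show w + (n - w) = n by omega] at this
    have hnw : ((n - w : ℕ) : A) = n - w := by push_cast [hge]; rfl
    have hfG : ∀ i, a.field (c i) G = g i + ∑ j, s j * a.field (c i) (g j) := by
      intro i
      simp [G, map_sum, Derivation.leibniz, hs.field_apply, Finset.sum_add_distrib, add_comm]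
    refine ⟨q • G, h.smul_mem q hG, ?_, ?_, ?_⟩
    · refine h.mem_sweepIdeal_of_field hw hρ n _ (sub_mem hf (h.smul_mem q hG)) hn
        fun i => ?_
      -- Closedness: modulo `J` both terms are second derivatives of `f`, and the fields commute.
      have h1 : ∀ j, a.field (c i) (g j) - a.field (c j) (g i) ∈ J := by
        intro j
        have e1 := a.field_mem_sweepIdeal (hgJ j) (c i)
        have e2 := a.field_mem_sweepIdeal (hgJ i) (c j)
        rw [map_sub] at e1 e2
        rw [field_comm] at e1
        have := sub_mem e2 e1
        convert this using 1; ring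
      -- Closedness swaps the indices in `hfG`; Euler's relation for `g i` in degree `n - w` then
      -- gives `w + (n - w) = n`. The factor `q = w / n` compensates for this.
      have h2 : (w : A) * a.field (c i) G - n * g i ∈ J := by
        have : (w : A) * a.field (c i) G - n * g i =
            w * ∑ j, s j * (a.field (c i) (g j) - a.field (c j) (g i)) := by
          have := hgE i
          rw [hnw] at this
          rw [hfG]
          simp only [mul_sub, Finset.sum_sub_distrib]
          linear_combination this
        rw [this]
        exact J.mul_mem_left _ (sum_mem fun j _ => J.mul_mem_left _ (h1 j))
      have h3 : (w : A) * (a.field (c i) (f - q • G)) ∈ J := by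
        have hq : (n : A) * algebraMap A₀ A q = w := by
          simpa using congrArg (algebraMap A₀ A) hnq
        have := J.sub_mem (J.mul_mem_left (w : A) (hgJ i)) (J.mul_mem_left (algebraMap A₀ A q) h2)
        convert this using 1
        rw [map_sub, Derivation.map_smul, Algebra.smul_def]
        linear_combination -(g i) * hq
      have h4 := J.mul_mem_left (algebraMap ℚ A (w : ℚ)⁻¹) h3
      rwa [← mul_assoc, ← map_natCast (algebraMap ℚ A), ← map_mul,
        inv_mul_cancel₀ (by exact_mod_cast hw.ne'), map_one, one_mul] at h4
    · intro i
      rw [Derivation.map_smul, map_sum]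
      simp [Derivation.leibniz, hgρ, hs.transverse_slice]
    · have h5 : (w : A) * ∑ j, s j * a.field (c j) G = n * G := by
        calc (w : A) * ∑ j, s j * a.field (c j) G
            = w * G + ∑ i, s i * ((w : A) * ∑ j, s j * a.field (c j) (g i)) := by
              simp only [hfG, mul_add, Finset.sum_add_distrib, G]
              congr 1
              simp only [Finset.mul_sum]
              rw [Finset.sum_comm]
              exact Finset.sum_congr rfl fun i _ => Finset.sum_congr rfl fun j _ => by ring
          _ = w * G + ∑ i, s i * (((n : A) - w) * g i) := by simp only [hgE, hnw]
          _ = n * G := by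
              have : ∑ i, s i * (((n : A) - w) * g i) = ((n : A) - w) * G := by
                simp only [G, Finset.mul_sum]
                exact Finset.sum_congr rfl fun i _ => by ring
              rw [this]; ring
      simp only [Derivation.map_smul]
      simp only [Algebra.smul_def]
      have h6 : ∑ j, s j * (algebraMap A₀ A q * a.field (c j) G) =
          algebraMap A₀ A q * ∑ j, s j * a.field (c j) G := by
        rw [Finset.mul_sum]; exact Finset.sum_congr rfl fun i _ => by ring
      rw [h6]
      linear_combination algebraMap A₀ A q * h5

-- Modulo the values of the transverse fields, a relation is determined linearly by its entries at
-- the indices `c l`. A matrix of relations therefore factors through `ι`, and its minors of size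
-- `card ι + 1` vanish.
omit [DecidableEq ι] in
theorem fittingIdeal_le_span_transverse (c : ι → Fin r) (s : ι → A) (j : ℤ)
    (hj : ((r : ℤ) - j).toNat = Fintype.card ι + 1) :
    fittingIdeal (M := a.Q) (Submodule.mkQ (LinearMap.range a.conormalMap)) j ≤
      Ideal.span {x | ∃ i f, x = a.transverse c s i f} := by
  set I := Ideal.span {x | ∃ i f, x = a.transverse c s i f} with hI
  have key : ∀ y ∈ LinearMap.ker (Submodule.mkQ (LinearMap.range a.conormalMap)), ∀ t,
      y t - ∑ l, y (c l) * a.field t (s l) ∈ I := by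
    intro y hy t
    rw [Submodule.ker_mkQ, range_conormalMap] at hy
    induction hy using Submodule.span_induction with
    | mem x hx =>
      obtain ⟨f, rfl⟩ := hx
      refine Ideal.subset_span ⟨t, f, ?_⟩
      simp [transverse_apply, vectorFields_apply, mul_comm]
    | zero => simp
    | add x y _ _ hx hy =>
      convert I.add_mem hx hy using 1
      simp [add_mul, Finset.sum_add_distrib]; ring
    | smul b x _ hx =>
      convert I.mul_mem_left b hx using 1
      simp [mul_sub, Finset.mul_sum, mul_assoc]
  refine Ideal.span_le.mpr ?_
  rintro _ ⟨rel, col, rfl⟩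
  rw [SetLike.mem_coe, ← Ideal.Quotient.eq_zero_iff_mem, RingHom.map_det]
  have : (Ideal.Quotient.mk I).mapMatrix (Matrix.of fun s t => (rel s : Fin r → A) (col t)) =
      (Matrix.of fun n l => Ideal.Quotient.mk I ((rel n : Fin r → A) (c l))) *
      (Matrix.of fun l n => Ideal.Quotient.mk I (a.field (col n) (s l))) := by
    ext n t
    have := key _ (rel n).2 (col t)
    rw [← Ideal.Quotient.eq_zero_iff_mem, map_sub, sub_eq_zero] at this
    simpa [Matrix.mul_apply] using this
  rw [this]
  exact Matrix.det_mul_eq_zero_of_card_lt (by simpa using hj) _ _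

/-- A non-zero element of the Fitting ideal in degree `e` produces a function on the
centre's ideal which is not annihilated by the transverse fields. -/
theorem IsSlice.exists_transverse_ne_zero [Algebra ℚ A₀] [Algebra ℚ A] [GradedRing 𝒜]
    (hw : 0 < w) (h : a.IsHomogeneous w 𝒜) {c : ι → Fin r} {s : ι → A} (hs : a.IsSlice w 𝒜 c s)
    (hρ : ∀ f ∈ 𝒜 w, ∀ i, a.transverse c s i f = 0) {j : ℤ}
    (hj : ((r : ℤ) - j).toNat = Fintype.card ι + 1) {e : ℕ} {x : A}
    (hx : x ∈ fittingIdeal (M := a.Q) (Submodule.mkQ (LinearMap.range a.conormalMap)) j)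
    (hxe : x ∈ 𝒜 e) (hx0 : x ≠ 0) :
    ∃ n ≤ e, ∃ f ∈ 𝒜 (n + w), f ∈ a.sweepIdeal (irrelevant 𝒜).toIdeal ∧
      ∃ i, a.transverse c s i f ≠ 0 := by
  classical
  by_contra! hcon
  -- Subtracting the integrated function moves `f` into the ideal of the centre without changing its
  -- transverse derivatives.
  have hzero : ∀ n ≤ e, ∀ f ∈ 𝒜 (n + w), ∀ i, a.transverse c s i f = 0 := by
    intro n hn f hf i
    obtain ⟨g, hg, hgJ, hgρ, -⟩ := hs.exists_sub_mem_sweepIdeal hw h hρ _ f hf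
    have := hcon n hn _ (sub_mem hf hg) hgJ i
    rwa [map_sub, hgρ, sub_zero] at this
  -- The values of the transverse fields would generate an ideal living in degrees above `e`. The
  -- multiplier `b` makes the claim stable under scalar multiplication.
  have hlow : ∀ y ∈ Ideal.span {x | ∃ i f, x = a.transverse c s i f}, ∀ b, ∀ n ≤ e,
      GradedRing.proj 𝒜 n (b * y) = 0 := by
    intro y hy
    induction hy using Submodule.span_induction with
    | mem x hx =>
      obtain ⟨i, f, rfl⟩ := hx
      intro b n hn
      rw [← DirectSum.sum_support_decompose 𝒜 f, map_sum, Finset.mul_sum, map_sum]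
      refine Finset.sum_eq_zero fun l _ => ?_
      rw [← DirectSum.sum_support_decompose 𝒜 b, Finset.sum_mul, map_sum]
      refine Finset.sum_eq_zero fun l' _ => ?_
      rcases lt_or_ge l w with hl | hl
      · rw [h.transverse_eq_zero (DirectSum.decompose 𝒜 f l).2 hl, mul_zero, map_zero]
      · rcases le_or_gt (l - w) e with hle | hgt
        · rw [hzero (l - w) hle _ (by
            rw [show l - w + w = l by omega]; exact (DirectSum.decompose 𝒜 f l).2), mul_zero,
            map_zero]
        · have hm := SetLike.mul_mem_graded (DirectSum.decompose 𝒜 b l').2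
            (hs.transverse_mem h (DirectSum.decompose 𝒜 f l).2 (j := l - w) (by omega) i)
          exact DirectSum.decompose_of_mem_ne 𝒜 hm (by omega)
    | zero => simp
    | add x y _ _ hx hy =>
      intro b n hn
      rw [mul_add, map_add, hx b n hn, hy b n hn, add_zero]
    | smul b' x _ hx =>
      intro b n hn
      rw [smul_eq_mul, ← mul_assoc]
      exact hx _ n hn
  have := hlow x (fittingIdeal_le_span_transverse c s j hj hx) 1 e le_rfl
  rw [one_mul, GradedRing.proj_apply, DirectSum.decompose_of_mem_same 𝒜 hxe] at this
  exact hx0 this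

end Slice

end GaCoaction

/-! ### Homogeneous generators of locally principal ideals. -/

/-- Nakayama's argument: if no element of `T` were a generator, all of them would lie in `𝔪 γ`,
giving `γ = b γ` with `b ∈ 𝔪`. -/
theorem exists_span_singleton_eq_of_span_eq {O : Type*} [CommRing O] [IsDomain O] [IsLocalRing O]
    {T : Set O} {γ : O} (hγ : γ ≠ 0) (hT : Ideal.span T = Ideal.span {γ}) :
    ∃ t ∈ T, Ideal.span {t} = Ideal.span {γ} := by
  by_contra! hcon
  have hle : Ideal.span T ≤ IsLocalRing.maximalIdeal O * Ideal.span {γ} := by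
    refine Ideal.span_le.mpr fun t ht => ?_
    have h1 : t ∈ Ideal.span {γ} := hT ▸ Ideal.subset_span ht
    obtain ⟨b, rfl⟩ := Ideal.mem_span_singleton'.mp h1
    refine Ideal.mul_mem_mul ?_ (Ideal.mem_span_singleton_self γ)
    rw [IsLocalRing.mem_maximalIdeal]
    intro hb
    exact hcon _ ht (Ideal.span_singleton_mul_left_unit hb γ)
  have h2 : γ ∈ IsLocalRing.maximalIdeal O * Ideal.span {γ} :=
    hle (hT ▸ Ideal.mem_span_singleton_self γ)
  obtain ⟨b, hb, hbγ⟩ := Ideal.mem_mul_span_singleton.mp h2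
  have : b = 1 := mul_right_cancel₀ hγ (by rw [hbγ, one_mul])
  exact (IsLocalRing.mem_maximalIdeal b).mp hb (this ▸ isUnit_one)

/-- Compare the components of degree `n`: the degree-zero part of `b` is non-zero, and it multiplies
`F` to the component of `t` in degree `n - δ` times `G`. -/
theorem exists_homogeneous_mul_eq {A : Type*} [CommRing A] [IsDomain A]
    (𝒜 : ℕ → AddSubgroup A) [GradedRing 𝒜] {b t F G : A} {n δ : ℕ}
    (hb : b ∉ (HomogeneousIdeal.irrelevant 𝒜).toIdeal) (hF : F ∈ 𝒜 n) (hF0 : F ≠ 0)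
    (hG : G ∈ 𝒜 δ) (h : b * F = t * G) :
    δ ≤ n ∧ ∃ a₀ ∈ 𝒜 0, a₀ ≠ 0 ∧ ∃ c ∈ 𝒜 (n - δ), a₀ * F = c * G := by
  have hb0 : (DirectSum.decompose 𝒜 b 0 : A) ≠ 0 := by
    intro h0
    exact hb ((HomogeneousIdeal.mem_irrelevant_iff 𝒜 b).mpr h0)
  have h1 := congrArg (fun x => (DirectSum.decompose 𝒜 x n : A)) h
  simp only [DirectSum.coe_decompose_mul_of_right_mem_of_le 𝒜 hF le_rfl] at h1
  rw [show n - n = 0 from Nat.sub_self n] at h1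
  have hle : δ ≤ n := by
    by_contra hlt
    rw [DirectSum.coe_decompose_mul_of_right_mem_of_not_le 𝒜 hG hlt] at h1
    exact mul_ne_zero hb0 hF0 h1
  rw [DirectSum.coe_decompose_mul_of_right_mem_of_le 𝒜 hG hle] at h1
  exact ⟨hle, _, (DirectSum.decompose 𝒜 b 0).2, hb0, _, (DirectSum.decompose 𝒜 t (n - δ)).2, h1⟩

namespace GaCoaction

open HomogeneousIdeal

/-! ### Drop of the Fitting degree along an equivariant map. -/

section Equivariant

variable {r w : ℕ} {A₀ A A₀' A' : Type u} [CommRing A₀] [CommRing A] [Algebra A₀ A]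
  [CommRing A₀'] [CommRing A'] [Algebra A₀' A']
  {a : GaCoaction r A₀ A} {a' : GaCoaction r A₀' A'}
  {𝒜 : ℕ → AddSubgroup A} {𝒜' : ℕ → AddSubgroup A'}
  {φ : A →+* A'} (hσ : ∀ f, a'.σ (φ f) = MvPolynomial.map φ (a.σ f))

include hσ

theorem field_map (i : Fin r) (f : A) : a'.field i (φ f) = φ (a.field i f) := by
  rw [field_eq_coeff, field_eq_coeff, hσ, MvPolynomial.coeff_map]

/-- Fitting ideals of `Q` are compatible with equivariant maps. -/
theorem map_mem_fittingIdeal {j : ℤ} {x : A}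
    (hx : x ∈ fittingIdeal (M := a.Q) (Submodule.mkQ (LinearMap.range a.conormalMap)) j) :
    φ x ∈ fittingIdeal (M := a'.Q) (Submodule.mkQ (LinearMap.range a'.conormalMap)) j := by
  have hker : ∀ y ∈ LinearMap.ker (Submodule.mkQ (LinearMap.range a.conormalMap)),
      (fun i => φ (y i)) ∈ LinearMap.ker (Submodule.mkQ (LinearMap.range a'.conormalMap)) := by
    intro y hy
    rw [Submodule.ker_mkQ, range_conormalMap] at hy ⊢
    induction hy using Submodule.span_induction with
    | mem x hx =>
      obtain ⟨f, rfl⟩ := hx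
      refine Submodule.subset_span ⟨φ f, ?_⟩
      ext i
      exact field_map hσ i f
    | zero =>
      convert Submodule.zero_mem _ using 1
      ext i; simp
    | add x y _ _ hx hy =>
      convert Submodule.add_mem _ hx hy using 1
      ext i; simp
    | smul b x _ hx =>
      convert Submodule.smul_mem _ (φ b) hx using 1
      ext i; simp
  rw [← Ideal.mem_comap]
  refine (Ideal.span_le.mpr ?_ : fittingIdeal _ j ≤ _) hx
  rintro _ ⟨rel, col, rfl⟩
  refine Ideal.subset_span ⟨fun s => ⟨_, hker _ (rel s).2⟩, col, ?_⟩
  rw [RingHom.map_det]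
  rfl

variable {ι : Type*} [Fintype ι]

theorem transverse_map (c : ι → Fin r) (s : ι → A) (i : Fin r) (f : A) :
    a'.transverse c (φ ∘ s) i (φ f) = φ (a.transverse c s i f) := by
  simp [transverse_apply, field_map hσ]

omit [Fintype ι] in
theorem IsSlice.map [DecidableEq ι] (hφ : ∀ n, ∀ f ∈ 𝒜 n, φ f ∈ 𝒜' n) {c : ι → Fin r} {s : ι → A}
    (hs : a.IsSlice w 𝒜 c s) : a'.IsSlice w 𝒜' c (φ ∘ s) where
  mem j := hφ _ _ (hs.mem j)
  field_apply i j := by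
    rw [Function.comp_apply, field_map hσ, hs.field_apply]
    split_ifs <;> simp

-- The slice block of this matrix is the identity, and its Schur complement is the transverse
-- derivative.
omit hσ in
theorem IsSlice.det_eq_transverse [DecidableEq ι] {c : ι → Fin r} {s : ι → A}
    (hs : a.IsSlice w 𝒜 c s) (i : Fin r) (f : A) :
    (Matrix.of fun (x : ι ⊕ Unit) (t : ι ⊕ Unit) =>
      a.field (Sum.elim c (fun _ => i) t) (Sum.elim s (fun _ => f) x)).det =
      a.transverse c s i f := by
  have h : (Matrix.of fun (x : ι ⊕ Unit) (t : ι ⊕ Unit) =>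
      a.field (Sum.elim c (fun _ => i) t) (Sum.elim s (fun _ => f) x)) =
      Matrix.fromBlocks 1 (Matrix.of fun x _ => a.field i (s x))
        (Matrix.of fun _ t => a.field (c t) f) (Matrix.of fun _ _ => a.field i f) := by
    ext (x | x) (t | t)
    · simp [hs.field_apply, Matrix.one_apply, eq_comm]
    all_goals simp
  rw [h, Matrix.det_fromBlocks_one₁₁, Matrix.det_unique]
  simp [transverse_apply, Matrix.mul_apply, mul_comm]

omit hσ in
theorem IsSlice.transverse_mem_fittingIdeal [DecidableEq ι] {c : ι → Fin r} {s : ι → A}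
    (hs : a.IsSlice w 𝒜 c s) {j : ℤ} (hj : ((r : ℤ) - j).toNat = Fintype.card ι + 1)
    (i : Fin r) (f : A) :
    a.transverse c s i f ∈
      fittingIdeal (M := a.Q) (Submodule.mkQ (LinearMap.range a.conormalMap)) j :=
  hs.det_eq_transverse i f ▸ a.det_mem_fittingIdeal (κ := ι ⊕ Unit) j (by simpa using hj)
    (Sum.elim s fun _ => f) (Sum.elim c fun _ => i)

/-- The degree of the Fitting ideal drops along an equivariant map `A → A'` for which
the centre becomes principal near the zero section. -/
theorem IsSlice.exists_fittingIdeal_degree_lt [DecidableEq ι] [GradedRing 𝒜] [GradedRing 𝒜']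
    [IsDomain A'] (hw : 0 < w)
    (h : a.IsHomogeneous w 𝒜) (h' : a'.IsHomogeneous w 𝒜') (hφ : ∀ n, ∀ f ∈ 𝒜 n, φ f ∈ 𝒜' n)
    (hinj : Function.Injective φ) {c : ι → Fin r} {s : ι → A} (hs : a.IsSlice w 𝒜 c s)
    {j : ℤ} (hj : ((r : ℤ) - j).toNat = Fintype.card ι + 1)
    {O : Type*} [CommRing O] [IsDomain O] [IsLocalRing O] (θ : A' →+* O)
    (hθ : Function.Injective θ)
    (hO : ∀ o : O, ∃ b ∉ (irrelevant 𝒜').toIdeal, ∃ t, θ b * o = θ t)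
    {γ : O} (hγ : γ ≠ 0)
    (hJ : (a.sweepIdeal (irrelevant 𝒜).toIdeal).map (θ.comp φ) = Ideal.span {γ})
    {n : ℕ} {f : A} (hf : f ∈ 𝒜 (n + w)) (hfJ : f ∈ a.sweepIdeal (irrelevant 𝒜).toIdeal)
    {i : Fin r} (hi : a.transverse c s i f ≠ 0) :
    ∃ n' < n, ∃ x ∈ fittingIdeal (M := a'.Q) (Submodule.mkQ (LinearMap.range a'.conormalMap)) j,
      x ∈ 𝒜' n' ∧ x ≠ 0 := by
  classical
  set J := a.sweepIdeal (irrelevant 𝒜).toIdeal with hJdef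
  -- Homogeneous generators, so that the one that generates locally has a degree.
  let T : Set A := {x | x ∈ J ∧ ∃ n, x ∈ 𝒜 n}
  have hT : J = Ideal.span T := by
    refine le_antisymm (fun x hx => ?_) (Ideal.span_le.mpr fun x hx => hx.1)
    rw [← DirectSum.sum_support_decompose 𝒜 x]
    exact sum_mem fun l _ => Ideal.subset_span
      ⟨h.component_mem_sweepIdeal hx l, l, (DirectSum.decompose 𝒜 x l).2⟩
  rw [hT, Ideal.map_span] at hJ
  obtain ⟨_, ⟨g, ⟨hgJ, δ, hg⟩, rfl⟩, hgγ⟩ := exists_span_singleton_eq_of_span_eq hγ hJ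
  -- Up to a non-zero factor of degree 0, `g` divides every homogeneous element of `J`. In
  -- particular no such non-zero element has degree below `δ`.
  have hdiv : ∀ l, ∀ x ∈ 𝒜 l, x ∈ J → x ≠ 0 →
      δ ≤ l ∧ ∃ a₀ ∈ 𝒜' 0, a₀ ≠ 0 ∧ ∃ c ∈ 𝒜' (l - δ), a₀ * φ x = c * φ g := by
    intro l x hx hxJ hx0
    have h1 : θ (φ x) ∈ Ideal.span {(θ.comp φ) g} := by
      rw [hgγ, ← hJ]
      exact Ideal.subset_span ⟨x, ⟨hxJ, l, hx⟩, rfl⟩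
    obtain ⟨o, ho⟩ := Ideal.mem_span_singleton'.mp h1
    obtain ⟨b, hb, t, hbt⟩ := hO o
    refine exists_homogeneous_mul_eq 𝒜' (t := t) hb (hφ _ _ hx)
      ((map_ne_zero_iff φ hinj).mpr hx0) (hφ _ _ hg) (hθ ?_)
    rw [map_mul, map_mul, ← hbt, ← ho, RingHom.comp_apply]
    ring
  have hf0 : f ≠ 0 := by rintro rfl; simp at hi
  have hg0 : g ≠ 0 := by
    rintro rfl
    rw [map_zero, eq_comm, Ideal.span_singleton_eq_span_singleton] at hgγ
    exact hγ ((associated_zero_iff_eq_zero γ).mp hgγ)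
  have hδ : 0 < δ := by
    rcases Nat.eq_zero_or_pos δ with rfl | hδ
    · exact (hg0 (eq_zero_of_mem_sweepIdeal hg hgJ)).elim
    · exact hδ
  -- Otherwise this would be a non-zero element of `J` of degree `δ - w < δ`.
  have hgρ : a.transverse c s i g = 0 := by
    rcases lt_or_ge δ w with hlt | hge
    · exact h.transverse_eq_zero hg hlt i
    · by_contra hne
      have := (hdiv (δ - w) _ (hs.transverse_mem h hg (by omega) i)
        (transverse_mem_sweepIdeal c s i hgJ) hne).1
      omega
  obtain ⟨hle, a₀, ha₀, ha₀0, y, hy, hmul⟩ := hdiv _ f hf hfJ hf0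
  have hs' : a'.IsSlice w 𝒜' c (φ ∘ s) := hs.map hσ hφ
  -- The factor `a₀` comes from the base, so derivations are linear over it.
  obtain ⟨α, rfl⟩ := (h'.mem_zero_iff a₀).mp ha₀
  have hρ : algebraMap A₀' A' α * φ (a.transverse c s i f) =
      φ g * a'.transverse c (φ ∘ s) i y := by
    have := congrArg (a'.transverse c (φ ∘ s) i) hmul
    rwa [← Algebra.smul_def, Derivation.map_smul, Derivation.leibniz, transverse_map hσ,
      transverse_map hσ, hgρ, map_zero, smul_zero, zero_add, Algebra.smul_def, smul_eq_mul] at this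
  have hy0 : a'.transverse c (φ ∘ s) i y ≠ 0 := by
    intro h0
    rw [h0, mul_zero] at hρ
    exact mul_ne_zero ha₀0 ((map_ne_zero_iff φ hinj).mpr hi) hρ
  -- This is `δ ≤ n`, so the subtraction `n - δ` below is not truncated: a `y` of degree less than
  -- `w` would be killed by the transverse field.
  have hδn : w ≤ n + w - δ := by
    by_contra hlt
    exact hy0 (h'.transverse_eq_zero hy (by omega) i)
  exact ⟨n - δ, by omega, _, hs'.transverse_mem_fittingIdeal hj i y,
    hs'.transverse_mem h' hy (by omega) i, hy0⟩

end Equivariant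

end GaCoaction

namespace GaCoaction

open HomogeneousIdeal

/-! ### Functoriality of the zero section and the centre. -/

section Functoriality

variable {r : ℕ} {A₀ A A₀' A' : Type u} [CommRing A₀] [CommRing A] [Algebra A₀ A]
  [CommRing A₀'] [CommRing A'] [Algebra A₀' A']
  {a : GaCoaction r A₀ A} {a' : GaCoaction r A₀' A'}
  {𝒜 : ℕ → AddSubgroup A} {𝒜' : ℕ → AddSubgroup A'} [GradedRing 𝒜] [GradedRing 𝒜']
  {φ : A →+* A'} (hφ : ∀ n, ∀ f ∈ 𝒜 n, φ f ∈ 𝒜' n)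

include hφ

theorem map_mem_irrelevant {x : A} (hx : x ∈ (irrelevant 𝒜).toIdeal) :
    φ x ∈ (irrelevant 𝒜').toIdeal := by
  rw [irrelevant_eq_span] at hx
  rw [← Ideal.mem_comap]
  refine (Ideal.span_le.mpr ?_) hx
  intro y hy
  simp only [Set.mem_iUnion] at hy
  obtain ⟨i, hi, hy⟩ := hy
  exact mem_irrelevant_of_mem 𝒜' hi (hφ i y hy)

/-- An injective graded map keeps a non-zero degree-zero part non-zero. This lets membership in the
centre's ideal descend from a smaller chart. -/
theorem mem_irrelevant_of_map (hinj : Function.Injective φ) {x : A}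
    (hx : φ x ∈ (irrelevant 𝒜').toIdeal) : x ∈ (irrelevant 𝒜).toIdeal := by
  let x₀ : A := (DirectSum.decompose 𝒜 x 0 : 𝒜 0)
  have hx₀0 : x₀ ∈ 𝒜 0 := (DirectSum.decompose 𝒜 x 0).2
  have h1 : x - x₀ ∈ (irrelevant 𝒜).toIdeal := by
    refine (mem_irrelevant_iff 𝒜 _).mpr ?_
    rw [map_sub, GradedRing.proj_apply, GradedRing.proj_apply,
      DirectSum.decompose_of_mem_same 𝒜 hx₀0, sub_self]
  have h2 : φ x₀ ∈ (irrelevant 𝒜').toIdeal := by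
    have := sub_mem hx (map_mem_irrelevant hφ h1)
    rwa [map_sub, sub_sub_cancel] at this
  have h3 : x₀ = 0 := by
    refine hinj ?_
    rw [map_zero]
    exact eq_zero_of_mem_irrelevant (hφ _ _ hx₀0) h2
  rwa [h3, sub_zero] at h1

theorem map_mem_sweepIdeal (hσ : ∀ f, a'.σ (φ f) = MvPolynomial.map φ (a.σ f)) {x : A}
    (hx : x ∈ a.sweepIdeal (irrelevant 𝒜).toIdeal) :
    φ x ∈ a'.sweepIdeal (irrelevant 𝒜').toIdeal := by
  rw [mem_sweepIdeal] at hx ⊢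
  intro m
  rw [hσ, MvPolynomial.coeff_map]
  exact map_mem_irrelevant hφ (hx m)

theorem mem_sweepIdeal_of_map (hσ : ∀ f, a'.σ (φ f) = MvPolynomial.map φ (a.σ f))
    (hinj : Function.Injective φ) {x : A}
    (hx : φ x ∈ a'.sweepIdeal (irrelevant 𝒜').toIdeal) :
    x ∈ a.sweepIdeal (irrelevant 𝒜).toIdeal := by
  rw [mem_sweepIdeal] at hx ⊢
  intro m
  have := hx m
  rw [hσ, MvPolynomial.coeff_map] at this
  exact mem_irrelevant_of_map hφ hinj this

end Functoriality

end GaCoaction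

/-! ### Cones on affine charts of the base. -/

namespace GradedCone

open HomogeneousIdeal

variable {k : Type u} [Field k] {r w : ℕ} (X : GradedCone k r w)

instance : IsIntegral X.C := X.integral_C
instance : IsIntegral X.S := X.integral_S
instance : IsAffineHom X.π := X.affine_π
instance : LocallyOfFiniteType (X.π ≫ X.str) := X.finiteType_C
instance : LocallyOfFiniteType X.str := X.finiteType_S

instance (U : X.S.affineOpens) : GradedRing (X.𝒜 U) :=
  { X.graded U, (X.decomposition U).chooseDecomposition with }

theorem isHomogeneous (U : X.S.affineOpens) : (X.coaction U).IsHomogeneous w (X.𝒜 U) :=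
  ⟨X.mem_zero_iff U, X.coeff_mem U⟩

theorem irrelevantIdeal_eq (U : X.S.affineOpens) :
    X.irrelevantIdeal U = (irrelevant (X.𝒜 U)).toIdeal :=
  (irrelevant_eq_span _).symm

theorem centre_eq (U : X.S.affineOpens) :
    X.centre U = (X.coaction U).sweepIdeal (irrelevant (X.𝒜 U)).toIdeal := by
  rw [centre, irrelevantIdeal_eq]

theorem isAffineOpen_preimage (U : X.S.affineOpens) : IsAffineOpen (X.π ⁻¹ᵁ U.1) :=
  U.2.preimage X.π

theorem preimage_nonempty (U : X.S.affineOpens) (hU : (U.1 : Set X.S).Nonempty) :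
    ((X.π ⁻¹ᵁ U.1 : X.C.Opens) : Set X.C).Nonempty := by
  by_contra hne
  have hbot : X.π ⁻¹ᵁ U.1 = ⊥ := by
    ext x; simpa using fun hx => (Set.not_nonempty_iff_eq_empty.mp hne).le hx
  have : Nonempty U.1 := hU.to_subtype
  have h1 : Subsingleton Γ(X.C, X.π ⁻¹ᵁ U.1) := by
    rw [hbot]; exact CommRingCat.subsingleton_of_isTerminal X.C.sheaf.isTerminalOfEmpty
  have h2 : (1 : Γ(X.S, U.1)) = 0 := X.injective_app U (Subsingleton.elim _ _)
  exact one_ne_zero h2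

theorem nonempty_of_ne_zero {U : X.S.affineOpens} {f : Γ(X.C, X.π ⁻¹ᵁ U.1)} (hf : f ≠ 0) :
    (U.1 : Set X.S).Nonempty := by
  by_contra hne
  have hbot : X.π ⁻¹ᵁ U.1 = ⊥ := by
    ext x
    simpa using fun hx => hne ⟨X.π x, hx⟩
  have h1 : Subsingleton Γ(X.C, X.π ⁻¹ᵁ U.1) := by
    rw [hbot]; exact CommRingCat.subsingleton_of_isTerminal X.C.sheaf.isTerminalOfEmpty
  exact hf (Subsingleton.elim _ _)

theorem isDomain (U : X.S.affineOpens) (hU : (U.1 : Set X.S).Nonempty) :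
    IsDomain Γ(X.C, X.π ⁻¹ᵁ U.1) := by
  have : Nonempty (X.π ⁻¹ᵁ U.1) := (X.preimage_nonempty U hU).to_subtype
  infer_instance

theorem preimageRes_injective {U V : X.S.affineOpens} (h : V.1 ≤ U.1)
    (hV : (V.1 : Set X.S).Nonempty) : Function.Injective (preimageRes X.π h) := by
  have : Nonempty (X.π ⁻¹ᵁ V.1) := (X.preimage_nonempty V hV).to_subtype
  exact map_injective_of_isIntegral X.C (homOfLE (X.π.preimage_mono h))

theorem preimageRes_mem_centre {U V : X.S.affineOpens} (h : V.1 ≤ U.1)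
    {f : Γ(X.C, X.π ⁻¹ᵁ U.1)} (hf : f ∈ X.centre U) : preimageRes X.π h f ∈ X.centre V := by
  rw [centre_eq] at hf ⊢
  exact GaCoaction.map_mem_sweepIdeal (X.res_mem U V h) (X.coaction_res U V h) hf

theorem mem_centre_of_preimageRes {U V : X.S.affineOpens} (h : V.1 ≤ U.1)
    (hV : (V.1 : Set X.S).Nonempty) {f : Γ(X.C, X.π ⁻¹ᵁ U.1)}
    (hf : preimageRes X.π h f ∈ X.centre V) : f ∈ X.centre U := by
  rw [centre_eq] at hf ⊢
  exact GaCoaction.mem_sweepIdeal_of_map (X.res_mem U V h) (X.coaction_res U V h)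
    (X.preimageRes_injective h hV) hf

theorem exists_preimageRes_eq_pow_mul {U V : X.S.affineOpens} (h : V.1 ≤ U.1) (c : Γ(X.S, U.1))
    (hc : X.S.basicOpen c = V.1) (f : Γ(X.C, X.π ⁻¹ᵁ V.1)) :
    ∃ (n : ℕ) (f' : Γ(X.C, X.π ⁻¹ᵁ U.1)),
      preimageRes X.π h f' = preimageRes X.π h ((X.π.app U.1).hom c) ^ n * f := by
  let := (X.C.presheaf.map (homOfLE (X.π.preimage_mono h)).op).hom.toAlgebra
  have hb : X.π ⁻¹ᵁ V.1 = X.C.basicOpen ((X.π.app U.1).hom c) := by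
    rw [← hc]; exact Scheme.preimage_basicOpen X.π c
  have hloc : IsLocalization (Submonoid.powers ((X.π.app U.1).hom c)) Γ(X.C, X.π ⁻¹ᵁ V.1) :=
    (X.isAffineOpen_preimage U).isLocalization_of_eq_basicOpen _
    (homOfLE (X.π.preimage_mono h)) hb
  obtain ⟨⟨f', ⟨_, n, rfl⟩⟩, hf'⟩ := IsLocalization.surj (Submonoid.powers ((X.π.app U.1).hom c)) f
  refine ⟨n, f', ?_⟩
  rw [mul_comm, ← map_pow]
  exact hf'.symm

/-- A function on `π⁻¹(U)` that does not vanish at `y` agrees, up to functions of the base, with a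
function on `π⁻¹(V)` that does not vanish at `y`. -/
theorem exists_preimageRes_eq_mul {U V : X.S.affineOpens} (f : Γ(X.C, X.π ⁻¹ᵁ U.1))
    {y : X.C} (hy : y ∈ X.C.basicOpen f) (hyV : y ∈ X.π ⁻¹ᵁ V.1) :
    ∃ (W : X.S.affineOpens) (hWU : W.1 ≤ U.1) (hWV : W.1 ≤ V.1), (W.1 : Set X.S).Nonempty ∧
      ∃ (g : Γ(X.C, X.π ⁻¹ᵁ V.1)) (v : Γ(X.S, W.1)),
        preimageRes X.π hWV g = (X.π.app W.1).hom v * preimageRes X.π hWU f ∧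
          y ∈ X.C.basicOpen g := by
  have hyU : y ∈ X.π ⁻¹ᵁ U.1 := X.C.basicOpen_le f hy
  obtain ⟨c, c', hcc, hyc⟩ := exists_basicOpen_le_affine_inter V.2 U.2 (X.π y) ⟨hyV, hyU⟩
  let W : X.S.affineOpens := ⟨X.S.basicOpen c, V.2.basicOpen c⟩
  have hWV : W.1 ≤ V.1 := X.S.basicOpen_le c
  have hWU : W.1 ≤ U.1 := by
    change X.S.basicOpen c ≤ U.1
    rw [hcc]; exact X.S.basicOpen_le c'
  obtain ⟨n, g, hg⟩ := X.exists_preimageRes_eq_pow_mul hWV c rfl (preimageRes X.π hWU f)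
  have hcu : IsUnit ((X.S.presheaf.map (homOfLE hWV).op).hom c) :=
    RingedSpace.isUnit_res_basicOpen X.S.toRingedSpace c
  have hres : preimageRes X.π hWV ((X.π.app V.1).hom c) =
      (X.π.app W.1).hom ((X.S.presheaf.map (homOfLE hWV).op).hom c) :=
    (congr($(X.π.naturality (homOfLE hWV).op).hom c)).symm
  rw [hres, ← map_pow] at hg
  refine ⟨W, hWU, hWV, ⟨_, hyc⟩, g, _, hg, ?_⟩
  have h1 : y ∈ X.C.basicOpen (preimageRes X.π hWV g) := by
    rw [hg, Scheme.basicOpen_mul]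
    refine ⟨?_, ?_⟩
    · rw [Scheme.basicOpen_of_isUnit _ ((hcu.pow n).map (X.π.app W.1).hom)]
      exact hyc
    · exact (Scheme.basicOpen_res X.C f (homOfLE (X.π.preimage_mono hWU)).op).ge ⟨hyc, hy⟩
  exact ((Scheme.basicOpen_res X.C g (homOfLE (X.π.preimage_mono hWV)).op).le h1).2

/-- The non-vanishing locus of the centre does not depend on the affine open subset. -/
theorem exists_mem_centre_mem_basicOpen {U V : X.S.affineOpens} {f : Γ(X.C, X.π ⁻¹ᵁ U.1)}
    (hf : f ∈ X.centre U) {y : X.C} (hy : y ∈ X.C.basicOpen f) (hyV : y ∈ X.π ⁻¹ᵁ V.1) :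
    ∃ g ∈ X.centre V, y ∈ X.C.basicOpen g := by
  obtain ⟨W, hWU, hWV, hW, g, v, hg, hyg⟩ := X.exists_preimageRes_eq_mul f hy hyV
  refine ⟨g, X.mem_centre_of_preimageRes hWV hW ?_, hyg⟩
  rw [hg]
  exact Ideal.mul_mem_left _ _ (X.preimageRes_mem_centre hWU hf)

/-- Away from the centre its ideal pulls back to the unit ideal, generated by the non-zero-divisor
1. -/
theorem pullsBackToCartier_of_forall_mem_basicOpen {U : X.S.affineOpens}
    {f : Γ(X.C, X.π ⁻¹ᵁ U.1)} (hf : f ∈ X.centre U) {T : Scheme.{u}} (F : T ⟶ X.C)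
    (hF : ∀ t, F t ∈ X.C.basicOpen f) : X.PullsBackToCartier X.centre F := by
  intro V t ht
  obtain ⟨g, hg, htg⟩ := X.exists_mem_centre_mem_basicOpen hf (hF t) (V := V) ht
  obtain ⟨W, hW, htW, hWle⟩ := exists_isAffineOpen_mem_and_subset (U := F ⁻¹ᵁ X.C.basicOpen g) htg
  have hWV : W ≤ F ⁻¹ᵁ X.π ⁻¹ᵁ V.1 := fun x hx => X.C.basicOpen_le g (hWle hx)
  refine ⟨⟨W, hW⟩, hWV, htW, 1, one_mem _, ?_⟩
  rw [Ideal.span_singleton_one]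
  refine Ideal.eq_top_of_isUnit_mem _ (Ideal.mem_map_of_mem _ hg) ?_
  have h1 := (RingedSpace.isUnit_res_basicOpen X.C.toRingedSpace g).map
    (F.appLE (X.C.basicOpen g) W hWle).hom
  convert h1 using 1
  exact (congr(($(F.map_appLE (U := X.C.basicOpen g) hWle
    (homOfLE (X.C.basicOpen_le g)).op)).hom g)).symm

end GradedCone

/-! ### The modification locally and its dominance. -/

namespace GradedCone

namespace Modification

variable {k : Type u} [Field k] {r w : ℕ} {X X' : GradedCone k r w}
  {J : (U : X.S.affineOpens) → Ideal Γ(X.C, X.π ⁻¹ᵁ U.1)} (M : X.Modification J X')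

instance : IsOpenImmersion M.ι := M.isOpenImmersion

theorem q_π_apply (x : X'.C) : M.q (X'.π x) = X.π ((M.ι ≫ M.b) x) := by
  have := congr($(M.comm) x)
  simpa using this

theorem preimage_le {U : X.S.affineOpens} {U' : X'.S.affineOpens} (h : U'.1 ≤ M.q ⁻¹ᵁ U.1) :
    X'.π ⁻¹ᵁ U'.1 ≤ (M.ι ≫ M.b) ⁻¹ᵁ X.π ⁻¹ᵁ U.1 := by
  intro x hx
  have h1 : M.q (X'.π x) ∈ U.1 := h hx
  rw [M.q_π_apply] at h1
  exact h1

theorem exists_affineOpen_mem (x : X'.C) {U : X.S.affineOpens}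
    (hx : (M.ι ≫ M.b) x ∈ X.π ⁻¹ᵁ U.1) :
    ∃ U' : X'.S.affineOpens, x ∈ X'.π ⁻¹ᵁ U'.1 ∧ U'.1 ≤ M.q ⁻¹ᵁ U.1 := by
  have hx' : X'.π x ∈ M.q ⁻¹ᵁ U.1 := by
    change M.q (X'.π x) ∈ U.1
    rw [M.q_π_apply]
    exact hx
  obtain ⟨U', hU', hxU', hle⟩ := exists_isAffineOpen_mem_and_subset hx'
  exact ⟨⟨U', hU'⟩, hxU', hle⟩

/-- The centre becomes principal, generated by a non-zero element, in the local rings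
of `C'`. -/
theorem exists_map_germ_eq_span (U : X.S.affineOpens) (V : X'.C.Opens)
    (hV : V ≤ (M.ι ≫ M.b) ⁻¹ᵁ X.π ⁻¹ᵁ U.1) (x : X'.C) (hx : x ∈ V) :
    ∃ γ : X'.C.presheaf.stalk x, γ ≠ 0 ∧
      (J U).map ((X'.C.presheaf.germ V x hx).hom.comp
        ((M.ι ≫ M.b).appLE (X.π ⁻¹ᵁ U.1) V hV).hom) = Ideal.span {γ} := by
  obtain ⟨W, hW, hxW, g, hg, hJg⟩ := M.isBlowup.cartier U (M.ι x) (hV hx)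
  let θ : Γ(M.B, W.1) ⟶ X'.C.presheaf.stalk x :=
    M.B.presheaf.germ W.1 (M.ι x) hxW ≫ M.ι.stalkMap x
  have hθ : M.b.appLE (X.π ⁻¹ᵁ U.1) W.1 hW ≫ θ =
      (M.ι ≫ M.b).appLE (X.π ⁻¹ᵁ U.1) V hV ≫ X'.C.presheaf.germ V x hx := by
    have h1 : M.b.appLE (X.π ⁻¹ᵁ U.1) W.1 hW ≫ M.B.presheaf.germ W.1 (M.ι x) hxW =
        M.b.app (X.π ⁻¹ᵁ U.1) ≫ M.B.presheaf.germ _ (M.ι x) (hW hxW) := by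
      rw [Scheme.Hom.appLE, Category.assoc, TopCat.Presheaf.germ_res]
    have h2 : (M.ι ≫ M.b).appLE (X.π ⁻¹ᵁ U.1) V hV ≫ X'.C.presheaf.germ V x hx =
        (M.ι ≫ M.b).app (X.π ⁻¹ᵁ U.1) ≫ X'.C.presheaf.germ _ x (hV hx) := by
      rw [Scheme.Hom.appLE, Category.assoc, TopCat.Presheaf.germ_res]
    have h3 : M.B.presheaf.germ _ (M.ι x) (hW hxW) ≫ M.ι.stalkMap x =
        M.ι.app (M.b ⁻¹ᵁ X.π ⁻¹ᵁ U.1) ≫ X'.C.presheaf.germ _ x (hV hx) :=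
      Scheme.Hom.germ_stalkMap ..
    rw [h2]
    exact ((Category.assoc _ _ _).symm.trans (congrArg (· ≫ M.ι.stalkMap x) h1)).trans
      ((Category.assoc _ _ _).trans ((congrArg (M.b.app (X.π ⁻¹ᵁ U.1) ≫ ·) h3).trans
        (Category.assoc _ _ _).symm))
  refine ⟨θ.hom g, ?_, ?_⟩
  -- A germ that vanishes is killed by some `s` outside the prime of the point; since `g` is a
  -- non-zero-divisor, `s = 0`, which is absurd.
  · intro h0
    have hinj : Function.Injective (M.ι.stalkMap x).hom :=
      (ConcreteCategory.bijective_of_isIso (M.ι.stalkMap x)).1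
    have h1 : (M.B.presheaf.germ W.1 (M.ι x) hxW).hom g = 0 := by
      refine hinj ?_
      rw [map_zero]
      exact h0
    let alg := M.B.presheaf.algebra_section_stalk ⟨M.ι x, hxW⟩
    have hloc := W.2.isLocalization_stalk ⟨M.ι x, hxW⟩
    obtain ⟨⟨s, hs⟩, hsg⟩ := (IsLocalization.map_eq_zero_iff
      (W.2.primeIdealOf ⟨M.ι x, hxW⟩).asIdeal.primeCompl
      (M.B.presheaf.stalk (M.ι x)) g).mp h1
    have hs0 : s = 0 := (mem_nonZeroDivisors_iff_right.mp hg) s hsg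
    exact hs (hs0 ▸ Ideal.zero_mem _)
  · rw [← CommRingCat.hom_comp, ← hθ, CommRingCat.hom_comp, ← Ideal.map_map, hJg, Ideal.map_span,
      Set.image_singleton]

end Modification

namespace Modification

variable {k : Type u} [Field k] {r w : ℕ} {X X' : GradedCone k r w}
  (M : X.Modification X.centre X')

/-- The blowing up is trivial off the centre. Some `f` in the centre's ideal stays non-zero on C',
so C' meets the preimage of `D(f)`. The universal property gives a section `g` of `b` over `D(f)`,
and the image of C' contains the non-empty open set where `g` lands in C'. As C is irreducible, this
set is dense. -/
theorem denseRange : DenseRange (M.ι ≫ M.b) := by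
  obtain ⟨x⟩ : Nonempty X'.C := inferInstance
  obtain ⟨U, hU, hxU, -⟩ := exists_isAffineOpen_mem_and_subset
    (TopologicalSpace.Opens.mem_top (X.π ((M.ι ≫ M.b) x)))
  obtain ⟨γ, hγ, hJ⟩ := M.exists_map_germ_eq_span ⟨U, hU⟩ _ le_rfl x hxU
  obtain ⟨f, hf, hf0⟩ : ∃ f ∈ X.centre ⟨U, hU⟩,
      ((M.ι ≫ M.b).appLE (X.π ⁻¹ᵁ U) _ le_rfl).hom f ≠ 0 := by
    by_contra! hcon
    refine hγ ?_
    rw [← Ideal.span_singleton_eq_bot, ← hJ, Ideal.map_eq_bot_iff_le_ker]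
    intro f hf
    rw [RingHom.mem_ker, RingHom.comp_apply, hcon f hf, map_zero]
  have hne : ∃ y, y ∈ (M.ι ≫ M.b) ⁻¹ᵁ X.C.basicOpen f := by
    by_contra! hcon
    refine hf0 ((basicOpen_eq_bot_iff _).mp (le_bot_iff.mp fun y hy => ?_))
    exact (hcon y ((Scheme.basicOpen_appLE _ _ _ _ _).le hy).2).elim
  obtain ⟨y, hy⟩ := hne
  let D := X.C.basicOpen f
  let p := M.ι ≫ M.b
  obtain ⟨g, hg, -⟩ := M.isBlowup.lift D.ι
    (X.pullsBackToCartier_of_forall_mem_basicOpen hf _ fun t => t.2)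
  obtain ⟨g', -, hg'⟩ := M.isBlowup.lift ((p ⁻¹ᵁ D).ι ≫ p)
    (X.pullsBackToCartier_of_forall_mem_basicOpen hf _ fun t => t.2)
  -- Both sides lift the same morphism to C, so uniqueness in the universal property identifies
  -- them.
  have hlift : (p ∣_ D) ≫ g = (p ⁻¹ᵁ D).ι ≫ M.ι := by
    rw [hg' ((p ∣_ D) ≫ g) (by simp only [Category.assoc, hg, morphismRestrict_ι]),
      hg' ((p ⁻¹ᵁ D).ι ≫ M.ι) (by simp [p])]
  let N : X.C.Opens := D.ι ''ᵁ (g ⁻¹ᵁ M.ι.opensRange)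
  have hN : (N : Set X.C) ⊆ Set.range p := by
    rintro _ ⟨t, ⟨x', hx'⟩, rfl⟩
    refine ⟨x', ?_⟩
    have h1 : M.b (g t) = D.ι t := congr($hg t)
    exact (congrArg M.b hx').trans h1
  have hNne : (N : Set X.C).Nonempty := by
    refine ⟨_, (p ∣_ D) ⟨y, hy⟩, ⟨y, ?_⟩, rfl⟩
    exact (congr($hlift ⟨y, hy⟩)).symm
  exact (N.isOpen.dense hNne).mono hN

theorem appLE_injective {U : X.S.affineOpens} {U' : X'.S.affineOpens}
    (hU' : (U'.1 : Set X'.S).Nonempty) (h : X'.π ⁻¹ᵁ U'.1 ≤ (M.ι ≫ M.b) ⁻¹ᵁ X.π ⁻¹ᵁ U.1) :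
    Function.Injective ((M.ι ≫ M.b).appLE (X.π ⁻¹ᵁ U.1) (X'.π ⁻¹ᵁ U'.1) h).hom := by
  rw [injective_iff_map_eq_zero]
  intro f hf
  by_contra hf0
  have hne : ((X.C.basicOpen f : X.C.Opens) : Set X.C).Nonempty := by
    by_contra hcon
    refine hf0 ((basicOpen_eq_bot_iff f).mp (le_bot_iff.mp fun y hy => ?_))
    exact (hcon ⟨y, hy⟩).elim
  obtain ⟨x, hx⟩ := M.denseRange.exists_mem_open (X.C.basicOpen f).isOpen hne
  obtain ⟨y, hy1, hy2⟩ := nonempty_preirreducible_inter (X'.π ⁻¹ᵁ U'.1).isOpen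
    ((M.ι ≫ M.b) ⁻¹ᵁ X.C.basicOpen f).isOpen (X'.preimage_nonempty U' hU') ⟨x, hx⟩
  have h1 := (Scheme.basicOpen_appLE (M.ι ≫ M.b) _ _ h f).ge ⟨hy1, hy2⟩
  erw [hf, Scheme.basicOpen_zero] at h1
  exact h1

theorem exists_affineOpen_le {U : X.S.affineOpens} (hU : (U.1 : Set X.S).Nonempty) :
    ∃ U' : X'.S.affineOpens, (U'.1 : Set X'.S).Nonempty ∧ U'.1 ≤ M.q ⁻¹ᵁ U.1 := by
  obtain ⟨x, hx⟩ := M.denseRange.exists_mem_open (X.π ⁻¹ᵁ U.1).isOpen (X.preimage_nonempty U hU)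
  obtain ⟨U', hxU', hle⟩ := M.exists_affineOpen_mem x hx
  exact ⟨U', ⟨_, hxU'⟩, hle⟩

end Modification

end GradedCone

/-! ### Annihilators and minors. -/

section LinearAlgebra

variable {K : Type*} [Field K]

theorem Matrix.finrank_ker_mulVecLin_add_rank {m n : Type*} [Fintype m] [Fintype n]
    (B : Matrix m n K) :
    Module.finrank K (LinearMap.ker B.mulVecLin) + B.rank = Fintype.card n := by
  rw [add_comm, Matrix.rank, LinearMap.finrank_range_add_finrank_ker, Module.finrank_pi]

/-- The annihilator of a set of vectors of rank `m` has codimension `m`, and a set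
of vectors of rank `m` has a non-zero minor of size `m`. -/
theorem exists_det_ne_zero_of_finrank_annihilator {n : Type*} [Fintype n] (T : Set (n → K))
    (N : Submodule K (n → K)) (hN : ∀ c, c ∈ N ↔ ∀ v ∈ T, ∑ i, c i * v i = 0) {m : ℕ}
    (hm : Module.finrank K N + m = Fintype.card n) :
    ∃ v : Fin m → (n → K), (∀ j, v j ∈ T) ∧ ∃ c : Fin m → n,
      (Matrix.of fun i j => v j (c i)).det ≠ 0 := by
  classical
  obtain ⟨b, hbT, hspan, hli⟩ := exists_linearIndependent K T
  have : Finite b := hli.finite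
  have := Fintype.ofFinite b
  let B : Matrix b n K := Matrix.of fun j => (j : n → K)
  have hker : N = LinearMap.ker B.mulVecLin := by
    ext c
    rw [hN, LinearMap.mem_ker]
    constructor
    · intro h
      ext j
      simpa [B, Matrix.mulVec, dotProduct, mul_comm] using h j (hbT j.2)
    · intro h v hv
      have hv' : v ∈ Submodule.span K b := hspan ▸ Submodule.subset_span hv
      clear hv
      induction hv' using Submodule.span_induction with
      | mem x hx =>
        have := congrFun h ⟨x, hx⟩
        simpa [B, Matrix.mulVec, dotProduct, mul_comm] using this
      | zero => simp
      | add x y _ _ hx hy => simp [mul_add, Finset.sum_add_distrib, hx, hy]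
      | smul a x _ hx =>
        simp only [Pi.smul_apply, smul_eq_mul, mul_left_comm _ a, ← Finset.mul_sum, hx, mul_zero]
  have hrank : B.rank = Fintype.card b := LinearIndependent.rank_matrix (M := B) hli
  have hcard : Fintype.card b = m := by
    have := B.finrank_ker_mulVecLin_add_rank
    rw [← hker, hrank] at this
    omega
  obtain ⟨κ, c, hc, hcspan, hcli⟩ := exists_linearIndependent' K (fun i => (fun j : b => B j i))
  have : Finite κ := Finite.of_injective c hc
  have := Fintype.ofFinite κ
  have hcardκ : Fintype.card κ = m := by
    rw [← finrank_span_eq_card hcli, hcspan, ← hcard, ← hrank, Matrix.rank_eq_finrank_span_cols]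
    rfl
  let e : Fin m ≃ b := (finCongr hcard.symm).trans (Fintype.equivFin b).symm
  let e' : Fin m ≃ κ := (finCongr hcardκ.symm).trans (Fintype.equivFin κ).symm
  refine ⟨fun j => e j, fun j => hbT (e j).2, fun i => c (e' i), ?_⟩
  rw [← isUnit_iff_ne_zero, ← Matrix.isUnit_iff_isUnit_det,
    ← Matrix.linearIndependent_rows_iff_isUnit]
  have h1 := hcli.comp e' e'.injective
  exact (h1.map' (LinearEquiv.funCongrLeft K K e).toLinearMap (LinearEquiv.ker _))

theorem finrank_add_card_le_of_det_ne_zero {n ι : Type*} [Fintype n] [Fintype ι] [DecidableEq ι]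
    (N : Submodule K (n → K)) (v : ι → (n → K)) (hN : ∀ c ∈ N, ∀ j, ∑ i, c i * v j i = 0)
    (c : ι → n) (hdet : (Matrix.of fun j i => v j (c i)).det ≠ 0) :
    Module.finrank K N + Fintype.card ι ≤ Fintype.card n := by
  let B : Matrix ι n K := Matrix.of v
  have hli : LinearIndependent K B.row := by
    have h1 : LinearIndependent K (Matrix.of fun j i => v j (c i)).row := by
      rw [Matrix.linearIndependent_rows_iff_isUnit, Matrix.isUnit_iff_isUnit_det]
      exact isUnit_iff_ne_zero.mpr hdet
    exact LinearIndependent.of_comp (LinearMap.funLeft K K c) h1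
  have hrank : B.rank = Fintype.card ι := LinearIndependent.rank_matrix hli
  have hle : N ≤ LinearMap.ker B.mulVecLin := by
    intro x hx
    rw [LinearMap.mem_ker]
    ext j
    simpa [B, Matrix.mulVec, dotProduct, mul_comm] using hN x hx j
  have := Submodule.finrank_mono hle
  have := B.finrank_ker_mulVecLin_add_rank
  omega

end LinearAlgebra

/-! ### Scalars and values at closed points. -/

section Scalars

variable {k : Type u} [Field k] {Y T : Scheme.{u}} (s : Y ⟶ Spec (.of k))

theorem appLE_scalar (F : T ⟶ Y) (V : Y.Opens) (W : T.Opens) (h : W ≤ F ⁻¹ᵁ V) (c : k) :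
    (F.appLE V W h).hom (scalar s V c) = scalar (F ≫ s) W c := by
  exact congr(($(Scheme.Hom.appLE_comp_appLE F s ⊤ V W le_top h)).hom
    ((Scheme.ΓSpecIso (.of k)).inv.hom c))

theorem res_scalar {V W : Y.Opens} (h : W ≤ V) (c : k) :
    (Y.presheaf.map (homOfLE h).op).hom (scalar s V c) = scalar s W c := by
  exact congr(($(Scheme.Hom.appLE_map s (U := ⊤) (V := V) le_top (homOfLE h).op)).hom
    ((Scheme.ΓSpecIso (.of k)).inv.hom c))

theorem evaluation_res {V W : Y.Opens} (h : W ≤ V) (x : Y) (hx : x ∈ W) (f : Γ(Y, V)) :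
    Y.evaluation W x hx ((Y.presheaf.map (homOfLE h).op).hom f) = Y.evaluation V x (h hx) f := by
  rw [← Scheme.germ_residue, ← Scheme.germ_residue]
  simp only [CommRingCat.comp_apply]
  congr 1
  exact TopCat.Presheaf.germ_res_apply ..

theorem evaluation_appLE_eq_zero_iff (F : T ⟶ Y) {V : Y.Opens} {W : T.Opens} (h : W ≤ F ⁻¹ᵁ V)
    (x : T) (hx : x ∈ W) (f : Γ(Y, V)) :
    T.evaluation W x hx ((F.appLE V W h).hom f) = 0 ↔ Y.evaluation V (F x) (h hx) f = 0 := by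
  have h1 := Scheme.basicOpen_appLE F W V h f
  have h2 : x ∈ T.basicOpen (F.appLE V W h f) ↔ F x ∈ Y.basicOpen f := by
    rw [h1]
    exact ⟨fun h => h.2, fun h => ⟨hx, h⟩⟩
  exact (T.evaluation_eq_zero_iff_notMem_basicOpen x hx _).trans
    ((not_congr h2).trans (Y.evaluation_eq_zero_iff_notMem_basicOpen (F x) (h hx) f).symm)

/-- The residue field of a closed point of a scheme locally of finite type over an algebraically
closed field is the base field. -/
theorem bijective_evaluation_scalar [IsAlgClosed k] [LocallyOfFiniteType s] (x : Y)
    (hx : IsClosed {x}) (V : Y.Opens) (hxV : x ∈ V) :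
    Function.Bijective ((Y.evaluation V x hxV).hom.comp (scalar s V)) := by
  have h1 : (Y.evaluation V x hxV).hom.comp (scalar s V) =
      (residueFieldIsoBase s x hx).inv.hom := by
    have h2 : (Y.evaluation V x hxV).hom.comp (scalar s V) =
        (Y.evaluation ⊤ x trivial).hom.comp (scalar s ⊤) := by
      ext c
      rw [RingHom.comp_apply, RingHom.comp_apply, ← res_scalar s (le_top : V ≤ ⊤) c]
      exact evaluation_res le_top x hxV _
    have h5 : (Y.fromSpecStalk x).appTop =
        Y.presheaf.germ ⊤ x (TopologicalSpace.Opens.mem_top x) ≫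
          (Scheme.ΓSpecIso (Y.presheaf.stalk x)).inv := by
      refine Scheme.fromSpecStalk_appTop.trans ?_
      refine congrArg (Y.presheaf.germ ⊤ x (TopologicalSpace.Opens.mem_top x) ≫ ·) ?_
      exact (congrArg ((Scheme.ΓSpecIso (Y.presheaf.stalk x)).inv ≫ ·)
        ((Spec (Y.presheaf.stalk x)).presheaf.map_id _)).trans (Category.comp_id _)
    have h3 : (Scheme.ΓSpecIso (.of k)).inv ≫ s.appTop ≫
        Y.presheaf.germ ⊤ x (TopologicalSpace.Opens.mem_top x) ≫ Y.residue x =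
        (residueFieldIsoBase s x hx).inv := by
      rw [← cancel_mono (Scheme.ΓSpecIso (Y.residueField x)).inv]
      rw [Scheme.ΓSpecIso_inv_naturality (residueFieldIsoBase s x hx).inv,
        SpecMap_residueFieldIsoBase_inv, Scheme.Hom.comp_appTop, Scheme.fromSpecResidueField,
        Scheme.Hom.comp_appTop, h5, Category.assoc, Category.assoc,
        Category.assoc, Category.assoc, ← Scheme.ΓSpecIso_inv_naturality (Y.residue x)]
    have h4 : s.appLE ⊤ ⊤ le_top = s.appTop := s.appLE_eq_app
    rw [h2, ← h3, ← h4]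
    rfl
  rw [h1]
  exact ConcreteCategory.bijective_of_isIso (residueFieldIsoBase s x hx).inv

end Scalars

namespace GaCoaction

open HomogeneousIdeal

section Slice

variable {r w : ℕ} {A₀ A : Type u} [CommRing A₀] [CommRing A] [Algebra A₀ A]
  {a : GaCoaction r A₀ A} {𝒜 : ℕ → AddSubgroup A} {ι : Type*} [Fintype ι] [DecidableEq ι]

/-- Functions of degree `w` with an invertible minor can be normalised to a slice. -/
theorem IsHomogeneous.exists_isSlice [GradedRing 𝒜] (h : a.IsHomogeneous w 𝒜) {c : ι → Fin r}
    {s : ι → A} (hs : ∀ j, s j ∈ 𝒜 w) (m : Matrix ι ι A₀)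
    (hm : ∀ i j, algebraMap A₀ A (m i j) = a.field (c i) (s j)) (hdet : IsUnit m.det) :
    ∃ s' : ι → A, a.IsSlice w 𝒜 c s' := by
  refine ⟨fun j => ∑ l, m⁻¹ l j • s l, ⟨fun j => sum_mem fun l _ => h.smul_mem _ (hs l), ?_⟩⟩
  intro i j
  have h1 := congrFun (congrFun (Matrix.mul_nonsing_inv m hdet) i) j
  rw [Matrix.mul_apply, Matrix.one_apply] at h1
  have h2 := congrArg (algebraMap A₀ A) h1
  rw [map_sum] at h2
  simp only [map_mul, hm] at h2
  have h3 : a.field (c i) (∑ l, m⁻¹ l j • s l) =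
      ∑ l, a.field (c i) (s l) * algebraMap A₀ A (m⁻¹ l j) := by
    rw [map_sum]
    refine Finset.sum_congr rfl fun l _ => ?_
    rw [Derivation.map_smul, Algebra.smul_def, mul_comm]
  rw [h3, h2]
  split_ifs <;> simp

end Slice

end GaCoaction

/-! ### Injective graded maps and the irrelevant prime. -/

section GradedMap

variable {A A' : Type*} [CommRing A] [CommRing A'] {𝒜 : ℕ → AddSubgroup A}
  {𝒜' : ℕ → AddSubgroup A'} [GradedRing 𝒜] [GradedRing 𝒜']

theorem mem_graded_of_map_mem {φ : A →+* A'} (hφ : ∀ n, ∀ f ∈ 𝒜 n, φ f ∈ 𝒜' n)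
    (hinj : Function.Injective φ) {x : A} {n : ℕ} (hx : φ x ∈ 𝒜' n) : x ∈ 𝒜 n := by
  classical
  have h1 : ∀ i, (DirectSum.decompose 𝒜' (φ x) i : A') = φ (DirectSum.decompose 𝒜 x i : A) := by
    intro i
    change GradedRing.proj 𝒜' i (φ x) = φ (GradedRing.proj 𝒜 i x)
    conv_lhs => rw [← DirectSum.sum_support_decompose 𝒜 x]
    conv_rhs => rw [← DirectSum.sum_support_decompose 𝒜 x]
    simp only [map_sum]
    refine Finset.sum_congr rfl fun l _ => ?_
    have hl := (DirectSum.decompose 𝒜 x l).2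
    by_cases hli : l = i
    · subst hli
      rw [GradedRing.proj_apply, GradedRing.proj_apply, DirectSum.decompose_of_mem_same _ hl,
        DirectSum.decompose_of_mem_same _ (hφ _ _ hl)]
    · rw [GradedRing.proj_apply, GradedRing.proj_apply, DirectSum.decompose_of_mem_ne _ hl hli,
        DirectSum.decompose_of_mem_ne _ (hφ _ _ hl) hli, map_zero]
  have h2 := h1 n
  rw [DirectSum.decompose_of_mem_same _ hx] at h2
  rw [hinj h2]
  exact (DirectSum.decompose 𝒜 x n).2

theorem isPrime_irrelevant [IsDomain A] : (HomogeneousIdeal.irrelevant 𝒜).toIdeal.IsPrime := by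
  rw [HomogeneousIdeal.toIdeal_irrelevant]
  exact RingHom.ker_isPrime _

end GradedMap

/-! ### Stabilisers on the zero section. -/

namespace GradedCone

open HomogeneousIdeal

variable {k : Type u} [Field k] {r w : ℕ} (X : GradedCone k r w)

section Values

variable [IsAlgClosed k] {z : X.C} (hz : IsClosed {z})

/-- The residue field at a closed point is `k`. -/
def residueEquiv : k ≃+* X.C.residueField z :=
  RingEquiv.ofBijective _
    (bijective_evaluation_scalar (X.π ≫ X.str) z hz ⊤ (TopologicalSpace.Opens.mem_top z))

/-- The value of a function at a closed point. -/
def value (V : X.C.Opens) (hzV : z ∈ V) : Γ(X.C, V) →+* k :=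
  (X.residueEquiv hz).symm.toRingHom.comp (X.C.evaluation V z hzV).hom

theorem value_eq_zero_iff {V : X.C.Opens} {hzV : z ∈ V} {f : Γ(X.C, V)} :
    X.value hz V hzV f = 0 ↔ X.C.evaluation V z hzV f = 0 :=
  map_eq_zero_iff (X.residueEquiv hz).symm (X.residueEquiv hz).symm.injective

theorem value_scalar (V : X.C.Opens) (hzV : z ∈ V) (c : k) :
    X.value hz V hzV (scalar (X.π ≫ X.str) V c) = c := by
  refine (RingEquiv.symm_apply_eq (X.residueEquiv hz)).mpr ?_
  rw [← res_scalar (X.π ≫ X.str) (le_top : V ≤ ⊤) c]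
  exact evaluation_res le_top z hzV _

theorem value_res {V W : X.C.Opens} (h : W ≤ V) (hzW : z ∈ W) (f : Γ(X.C, V)) :
    X.value hz W hzW ((X.C.presheaf.map (homOfLE h).op).hom f) = X.value hz V (h hzW) f :=
  congrArg (X.residueEquiv hz).symm (evaluation_res h z hzW f)

theorem mem_stab_iff (c : Fin r → k) :
    c ∈ X.stab z ↔ ∀ (U : X.S.affineOpens) (hzU : z ∈ X.π ⁻¹ᵁ U.1) (f : Γ(X.C, X.π ⁻¹ᵁ U.1)),
      ∑ i, c i * X.value hz _ hzU ((X.coaction U).field i f) = 0 := by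
  refine forall_congr' fun U => forall_congr' fun hzU => forall_congr' fun f => ?_
  rw [← X.value_eq_zero_iff hz, map_sum]
  simp only [map_mul, value_scalar]
  rfl

/-- On the zero section, the stabiliser is determined by the functions of degree `w`. -/
theorem mem_stab_iff_of_mem_zeroSection (hzZ : z ∈ X.zeroSection) (c : Fin r → k) :
    c ∈ X.stab z ↔ ∀ (U : X.S.affineOpens) (hzU : z ∈ X.π ⁻¹ᵁ U.1), ∀ f ∈ X.𝒜 U w,
      ∑ i, c i * X.value hz _ hzU ((X.coaction U).field i f) = 0 := by
  classical
  rw [X.mem_stab_iff hz]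
  refine ⟨fun h U hzU f _ => h U hzU f, fun h U hzU f => ?_⟩
  rw [← DirectSum.sum_support_decompose (X.𝒜 U) f]
  simp only [map_sum, Finset.mul_sum]
  rw [Finset.sum_comm]
  refine Finset.sum_eq_zero fun n _ => ?_
  have hn := (DirectSum.decompose (X.𝒜 U) f n).2
  rcases lt_trichotomy n w with hlt | heq | hlt
  · refine Finset.sum_eq_zero fun i _ => ?_
    rw [(X.isHomogeneous U).field_eq_zero hn hlt, map_zero, mul_zero]
  · subst heq
    exact h U hzU _ hn
  · refine Finset.sum_eq_zero fun i _ => ?_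
    rw [(X.value_eq_zero_iff hz).mpr (hzZ.2 U hzU (n - w) (by omega) _
      ((X.isHomogeneous U).field_mem hn (by omega) i)), mul_zero]

omit [IsAlgClosed k] in
theorem field_preimageRes {U V : X.S.affineOpens} (h : V.1 ≤ U.1) (i : Fin r)
    (f : Γ(X.C, X.π ⁻¹ᵁ U.1)) :
    (X.coaction V).field i (preimageRes X.π h f) =
      preimageRes X.π h ((X.coaction U).field i f) :=
  GaCoaction.field_map (X.coaction_res U V h) i f

/-- The stabiliser is the annihilator of the derivative vectors at `z` of functions of degree `w`,
so its codimension `m` is the rank of these vectors. -/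
theorem exists_minor_ne_zero (hzZ : z ∈ X.zeroSection) {m : ℕ}
    (hm : Module.finrank k (X.stab z) + m = r) :
    ∃ (U : X.S.affineOpens) (hzU : z ∈ X.π ⁻¹ᵁ U.1) (s : Fin m → Γ(X.C, X.π ⁻¹ᵁ U.1))
      (c : Fin m → Fin r), (∀ j, s j ∈ X.𝒜 U w) ∧
        X.value hz _ hzU (Matrix.of fun i j => (X.coaction U).field (c i) (s j)).det ≠ 0 := by
  let T : Set (Fin r → k) := {v | ∃ (U : X.S.affineOpens) (hzU : z ∈ X.π ⁻¹ᵁ U.1), ∃ f ∈ X.𝒜 U w,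
    v = fun i => X.value hz _ hzU ((X.coaction U).field i f)}
  obtain ⟨v, hvT, c, hdet⟩ := exists_det_ne_zero_of_finrank_annihilator T (X.stab z)
    (fun c => by
      rw [X.mem_stab_iff_of_mem_zeroSection hz hzZ]
      constructor
      · rintro h _ ⟨U, hzU, f, hf, rfl⟩
        exact h U hzU f hf
      · exact fun h U hzU f hf => h _ ⟨U, hzU, f, hf, rfl⟩) (m := m) (by simpa using hm)
  choose U hzU f hf hv using hvT
  -- The chosen functions live on different charts; there are finitely many, so they restrict to a
  -- common one.
  obtain ⟨W, hW, hzW, hWle⟩ := exists_isAffineOpen_mem_and_subset (x := X.π z)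
    (U := ⨅ j, (U j).1) (by
      rw [← SetLike.mem_coe, TopologicalSpace.Opens.coe_iInf]
      exact Set.mem_iInter.mpr fun j => hzU j)
  have hWU : ∀ j, W ≤ (U j).1 := fun j => (show W ≤ ⨅ j, (U j).1 from hWle).trans (iInf_le _ j)
  let V : X.S.affineOpens := ⟨W, hW⟩
  refine ⟨V, hzW, fun j => preimageRes X.π (V := V.1) (hWU j) (f j), c,
    fun j => X.res_mem (U j) V (hWU j) w _ (hf j), ?_⟩
  rw [RingHom.map_det]
  convert hdet using 2
  ext i j
  have h1 := X.field_preimageRes (V := V) (hWU j) (c i) (f j)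
  simp only [RingHom.mapMatrix_apply, Matrix.map_apply, Matrix.of_apply, hv, h1]
  exact X.value_res hz (X.π.preimage_mono (hWU j)) hzW _

theorem finrank_stab_add_card_le {U : X.S.affineOpens} (hzU : z ∈ X.π ⁻¹ᵁ U.1)
    {ι : Type*} [Fintype ι] [DecidableEq ι] (s : ι → Γ(X.C, X.π ⁻¹ᵁ U.1)) (c : ι → Fin r)
    (hdet : X.value hz _ hzU (Matrix.of fun j i => (X.coaction U).field (c i) (s j)).det ≠ 0) :
    Module.finrank k (X.stab z) + Fintype.card ι ≤ r := by
  rw [RingHom.map_det] at hdet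
  have := finrank_add_card_le_of_det_ne_zero (X.stab z)
    (fun j i => X.value hz _ hzU ((X.coaction U).field i (s j)))
    (fun x hx j => (X.mem_stab_iff hz x).mp hx U hzU (s j)) c hdet
  simpa using this

end Values

/-- Vanishing of the functions of positive degree can be tested on one affine open subset. -/
theorem mem_zeroSection_of_forall {z : X.C} (hz : IsClosed {z}) (V : X.S.affineOpens)
    (hzV : z ∈ X.π ⁻¹ᵁ V.1) (h : ∀ n > 0, ∀ f ∈ X.𝒜 V n, z ∉ X.C.basicOpen f) :
    z ∈ X.zeroSection := by
  refine ⟨hz, fun U hzU n hn f hf => ?_⟩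
  rw [Scheme.evaluation_eq_zero_iff_notMem_basicOpen]
  intro hzf
  obtain ⟨W, hWU, hWV, hW, g, v, hg, hzg⟩ := X.exists_preimageRes_eq_mul f hzf hzV
  refine h n hn g (mem_graded_of_map_mem (𝒜' := X.𝒜 W) (X.res_mem V W hWV)
    (X.preimageRes_injective hWV hW) ?_) hzg
  rw [hg]
  have := SetLike.mul_mem_graded ((X.isHomogeneous W).algebraMap_mem v) (X.res_mem U W hWU n f hf)
  rwa [zero_add] at this

/-- A non-zero function on the base does not vanish at some closed point of the zero section. -/
theorem exists_mem_zeroSection_mem_basicOpen (V : X.S.affineOpens) {h : Γ(X.C, X.π ⁻¹ᵁ V.1)}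
    (hh : h ∈ X.𝒜 V 0) (h0 : h ≠ 0) : ∃ z ∈ X.zeroSection, z ∈ X.C.basicOpen h := by
  have hV := X.nonempty_of_ne_zero h0
  have := X.isDomain V hV
  have hP : (irrelevant (X.𝒜 V)).toIdeal.IsPrime := isPrime_irrelevant
  let hA := X.isAffineOpen_preimage V
  -- The generic point of the zero section over `V`. It shows that the locus below is non-empty, and
  -- the Jacobson property then supplies a closed point.
  let x := hA.fromSpec ⟨_, hP⟩
  have hx : ∀ f, x ∈ X.C.basicOpen f ↔ f ∉ (irrelevant (X.𝒜 V)).toIdeal := by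
    intro f
    have := hA.fromSpec_preimage_basicOpen f
    change (⟨_, hP⟩ : PrimeSpectrum Γ(X.C, X.π ⁻¹ᵁ V.1)) ∈ hA.fromSpec ⁻¹ᵁ X.C.basicOpen f ↔ _
    rw [this]
    rfl
  let Z : Set X.C := ⋂ (f : Γ(X.C, X.π ⁻¹ᵁ V.1)) (_ : ∃ n > 0, f ∈ X.𝒜 V n),
    (X.C.basicOpen f : Set X.C)ᶜ
  have hZ : IsClosed Z := isClosed_biInter fun f _ => (X.C.basicOpen f).isOpen.isClosed_compl
  have : JacobsonSpace X.C := LocallyOfFiniteType.jacobsonSpace (X.π ≫ X.str)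
  obtain ⟨z, ⟨hzh, hzZ⟩, hz⟩ := nonempty_inter_closedPoints
    (Z := (X.C.basicOpen h : Set X.C) ∩ Z)
    ⟨x, (hx h).mpr fun hmem => h0 (GaCoaction.eq_zero_of_mem_irrelevant hh hmem),
      Set.mem_iInter₂.mpr fun f ⟨n, hn, hf⟩ hxf =>
        (hx f).mp hxf (mem_irrelevant_of_mem _ hn hf)⟩
    ((X.C.basicOpen h).isOpen.isLocallyClosed.inter hZ.isLocallyClosed)
  exact ⟨z, X.mem_zeroSection_of_forall hz V (X.C.basicOpen_le h hzh)
    fun n hn f hf hzf => Set.mem_iInter₂.mp hzZ f ⟨n, hn, hf⟩ hzf, hzh⟩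

end GradedCone

/-- A minor of size above `n` repeats a column. Consequently `e < ∞` forces `d > 0`. -/
theorem fittingIdeal_eq_bot_of_neg {R M : Type u} [CommRing R] [AddCommGroup M] [Module R M]
    {n : ℕ} (q : (Fin n → R) →ₗ[R] M) {j : ℤ} (hj : j < 0) : fittingIdeal q j = ⊥ := by
  rw [eq_bot_iff]
  refine Ideal.span_le.mpr ?_
  rintro _ ⟨rel, col, rfl⟩
  obtain ⟨s, t, hst, hcol⟩ := Fintype.exists_ne_map_eq_of_card_lt col (by
    simp only [Fintype.card_fin]; omega)
  exact Matrix.det_zero_of_column_eq hst fun i => by simp [hcol]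

/-! ### Comparison of the indices. -/

namespace GradedCone

open HomogeneousIdeal

variable {k : Type u} [Field k] {r w : ℕ}

namespace Modification

variable {X X' : GradedCone k r w} {J : (U : X.S.affineOpens) → Ideal Γ(X.C, X.π ⁻¹ᵁ U.1)}
  (M : X.Modification J X')

theorem comp_str : (M.ι ≫ M.b) ≫ X.π ≫ X.str = X'.π ≫ X'.str := by
  rw [← M.q_str, ← Category.assoc X'.π, M.comm]
  simp only [Category.assoc]

theorem map_mem_zeroSection [IsAlgClosed k] {z : X'.C} (hz : z ∈ X'.zeroSection) :
    (M.ι ≫ M.b) z ∈ X.zeroSection := by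
  refine ⟨?_, fun U hzU n hn f hf => ?_⟩
  -- Over an algebraically closed field closed points are `k`-points, and these compose with
  -- morphisms.
  · have h1 := pointOfClosedPoint_comp (X'.π ≫ X'.str) z hz.1
    let P : {p : Spec (.of k) ⟶ X.C // p ≫ X.π ≫ X.str = 𝟙 _} :=
      ⟨pointOfClosedPoint (X'.π ≫ X'.str) z hz.1 ≫ M.ι ≫ M.b, by
        rw [Category.assoc, M.comp_str, h1]⟩
    have h2 := (pointEquivClosedPoint (X.π ≫ X.str) P).2
    have h3 : ((pointEquivClosedPoint (X.π ≫ X.str) P) : X.C) = (M.ι ≫ M.b) z :=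
      congrArg (M.ι ≫ M.b) (pointOfClosedPoint_apply (X'.π ≫ X'.str) z hz.1 _)
    rw [h3] at h2
    exact h2
  · obtain ⟨U', hzU', hle⟩ := M.exists_affineOpen_mem z hzU
    have h := M.preimage_le hle
    refine (evaluation_appLE_eq_zero_iff (M.ι ≫ M.b) h z hzU' f).mp ?_
    exact hz.2 U' hzU' n hn _ (M.map_mem U U' h hle n f hf)

/-- By equivariance, differentiating a pulled-back function is pulling back its derivative, so a
field vanishing at `z` also vanishes at the image of `z`. -/
theorem stab_le (z : X'.C) : X'.stab z ≤ X.stab ((M.ι ≫ M.b) z) := by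
  intro c hc U hzU f
  obtain ⟨U', hzU', hle⟩ := M.exists_affineOpen_mem z hzU
  have h := M.preimage_le hle
  refine (evaluation_appLE_eq_zero_iff (M.ι ≫ M.b) h z hzU' _).mp ?_
  have h1 := hc U' hzU' (((M.ι ≫ M.b).appLE (X.π ⁻¹ᵁ U.1) (X'.π ⁻¹ᵁ U'.1) h).hom f)
  convert h1 using 2
  rw [map_sum]
  refine Finset.sum_congr rfl fun i _ => ?_
  rw [map_mul, appLE_scalar, M.comp_str]
  congr 1
  exact (GaCoaction.field_map (M.map_coaction U U' h hle) i f).symm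

theorem d_le [IsAlgClosed k] (M : X.Modification J X')
    (hd : ∀ z ∈ X.zeroSection, Module.finrank k (X.stab z) = X.d) :
    X'.d ≤ X.d := by
  rcases X'.zeroSection.eq_empty_or_nonempty with he | ⟨z, hz⟩
  -- Without points in the zero section, `d` takes the default value `sInf ∅ = 0`.
  · simp [d, he]
  · rw [← hd _ (M.map_mem_zeroSection hz)]
    have h : X'.d ≤ Module.finrank k (X'.stab z) := Nat.sInf_le ⟨z, hz, rfl⟩
    exact h.trans (Submodule.finrank_mono (M.stab_le z))

end Modification

section Generic

variable (X : GradedCone k r w)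

theorem e_lt_top_iff : X.e < ⊤ ↔ ∃ n : ℕ, X.e = n ∧
    ∃ U : X.S.affineOpens, ∃ f ∈ X.fit ((X.d : ℤ) - 1) U, f ∈ X.𝒜 U n ∧ f ≠ 0 := by
  constructor
  · intro he
    have hne : ((fun n : ℕ => (n : ℕ∞)) '' {n | ∃ U : X.S.affineOpens,
        ∃ f ∈ X.fit ((X.d : ℤ) - 1) U, f ∈ X.𝒜 U n ∧ f ≠ 0}).Nonempty := by
      by_contra hcon
      rw [Set.not_nonempty_iff_eq_empty] at hcon
      rw [e, hcon, sInf_empty] at he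
      exact he.ne rfl
    obtain ⟨n, hn, hne⟩ := csInf_mem hne
    exact ⟨n, hne.symm, hn⟩
  · rintro ⟨n, hn, -⟩
    rw [hn]; exact ENat.natCast_lt_top n

theorem d_pos (he : X.e < ⊤) : 0 < X.d := by
  obtain ⟨n, -, U, f, hf, -, hf0⟩ := X.e_lt_top_iff.mp he
  by_contra hd
  rw [fit, fittingIdeal_eq_bot_of_neg _ (by omega)] at hf
  exact hf0 hf

/-- Positivity excludes the default value `sInf ∅ = 0`, so the minimum is attained. -/
theorem exists_finrank_stab_eq (hd : 0 < X.d) :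
    ∃ z ∈ X.zeroSection, Module.finrank k (X.stab z) = X.d := by
  have := Nat.sInf_mem (Nat.nonempty_of_pos_sInf hd)
  obtain ⟨z, hz, hzd⟩ := this
  exact ⟨z, hz, hzd⟩

/-- The rank of the vector fields in degree `w` is at most `r - d`. -/
theorem transverse_eq_zero [IsAlgClosed k] {U : X.S.affineOpens} {ι : Type*} [Fintype ι]
    [DecidableEq ι] {c : ι → Fin r} {s : ι → Γ(X.C, X.π ⁻¹ᵁ U.1)}
    (hs : (X.coaction U).IsSlice w (X.𝒜 U) c s) (hι : X.d + Fintype.card ι = r)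
    {f : Γ(X.C, X.π ⁻¹ᵁ U.1)} (hf : f ∈ X.𝒜 U w) (i : Fin r) :
    (X.coaction U).transverse c s i f = 0 := by
  by_contra hne
  obtain ⟨z, hzZ, hzb⟩ := X.exists_mem_zeroSection_mem_basicOpen U
    (hs.transverse_mem (X.isHomogeneous U) hf (zero_add w) i) hne
  have hzU := X.C.basicOpen_le _ hzb
  -- A minor of size `r - d + 1` is non-zero at `z`, which would make the stabiliser there smaller
  -- than `d`.
  have h1 := X.finrank_stab_add_card_le hzZ.1 hzU (ι := ι ⊕ Unit) (Sum.elim s fun _ => f)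
    (Sum.elim c fun _ => i) (by
      rw [hs.det_eq_transverse i f, Ne, X.value_eq_zero_iff,
        Scheme.evaluation_eq_zero_iff_notMem_basicOpen, not_not]
      exact hzb)
  have h2 : X.d ≤ Module.finrank k (X.stab z) := Nat.sInf_le ⟨z, hzZ, rfl⟩
  simp only [Fintype.card_sum, Fintype.card_unit] at h1
  omega

/-- Slices exist on some non-empty open subset of any given one. -/
theorem exists_isSlice [IsAlgClosed k] (hd : 0 < X.d) (U : X.S.affineOpens)
    (hU : (U.1 : Set X.S).Nonempty) :
    X.d ≤ r ∧ ∃ V : X.S.affineOpens, (V.1 : Set X.S).Nonempty ∧ V.1 ≤ U.1 ∧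
      ∃ (c : Fin (r - X.d) → Fin r) (s : Fin (r - X.d) → Γ(X.C, X.π ⁻¹ᵁ V.1)),
        (X.coaction V).IsSlice w (X.𝒜 V) c s := by
  obtain ⟨z, hzZ, hzd⟩ := X.exists_finrank_stab_eq hd
  have hdr : X.d ≤ r := by
    have := Submodule.finrank_le (X.stab z)
    rwa [hzd, Module.finrank_fin_fun] at this
  refine ⟨hdr, ?_⟩
  obtain ⟨U₁, hzU₁, s, c, hs, hdet⟩ := X.exists_minor_ne_zero hzZ.1 hzZ (m := r - X.d) (by omega)
  -- The entries have degree 0, so the matrix lives on the base and its determinant can be inverted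
  -- by shrinking the base.
  have hm : ∀ i j, ∃ y : Γ(X.S, U₁.1), (X.π.app U₁.1).hom y =
      (X.coaction U₁).field (c i) (s j) := fun i j =>
    (X.mem_zero_iff U₁ _).mp ((X.isHomogeneous U₁).field_mem (hs j) (zero_add w) (c i))
  choose m hm using hm
  let μ : Matrix (Fin (r - X.d)) (Fin (r - X.d)) Γ(X.S, U₁.1) := Matrix.of m
  have hμ : μ.det ≠ 0 := by
    intro h0
    refine hdet ?_
    have h1 : (Matrix.of fun i j => (X.coaction U₁).field (c i) (s j)) =
        (X.π.app U₁.1).hom.mapMatrix μ := by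
      ext i j
      exact (hm i j).symm
    rw [h1, ← RingHom.map_det, h0, map_zero, map_zero]
  have hne : ((X.S.basicOpen μ.det : X.S.Opens) : Set X.S).Nonempty := by
    by_contra hcon
    refine hμ ((basicOpen_eq_bot_iff _).mp (le_bot_iff.mp fun y hy => ?_))
    exact (hcon ⟨y, hy⟩).elim
  obtain ⟨y, hyU, hyμ⟩ := nonempty_preirreducible_inter U.1.isOpen (X.S.basicOpen μ.det).isOpen
    hU hne
  obtain ⟨W, hW, hyW, hWle⟩ := exists_isAffineOpen_mem_and_subset
    (U := U.1 ⊓ X.S.basicOpen μ.det) ⟨hyU, hyμ⟩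
  have hWU : W ≤ U.1 := fun x hx => (hWle hx).1
  have hWμ : W ≤ X.S.basicOpen μ.det := fun x hx => (hWle hx).2
  have hWU₁ : W ≤ U₁.1 := hWμ.trans (X.S.basicOpen_le _)
  obtain ⟨V, hV⟩ : ∃ V : X.S.affineOpens, V.1 = W := ⟨⟨W, hW⟩, rfl⟩
  subst hV
  refine ⟨V, ⟨y, hyW⟩, hWU, c, ?_⟩
  let ρ : Γ(X.S, U₁.1) →+* Γ(X.S, V.1) := (X.S.presheaf.map (homOfLE hWU₁).op).hom
  refine (X.isHomogeneous V).exists_isSlice (s := fun j => preimageRes X.π hWU₁ (s j))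
    (fun j => X.res_mem U₁ V hWU₁ w _ (hs j)) (ρ.mapMatrix μ) ?_ ?_
  · intro i j
    rw [X.field_preimageRes, ← hm]
    exact congr($(X.π.naturality (homOfLE hWU₁).op).hom (m i j))
  · rw [← RingHom.map_det]
    have h1 := (RingedSpace.isUnit_res_basicOpen X.S.toRingedSpace μ.det).map
      (X.S.presheaf.map (homOfLE hWμ).op).hom
    convert h1 using 1
    exact congr(($(X.S.presheaf.map_comp (homOfLE (X.S.basicOpen_le μ.det)).op
      (homOfLE hWμ).op)).hom μ.det)

end Generic

/-- If `d` does not drop under the modification, then `e` does. -/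
theorem Modification.e_lt [IsAlgClosed k] [CharZero k] (hw : 0 < w) {X X' : GradedCone k r w}
    (M : X.Modification X.centre X') (he : X.e < ⊤) (hdd : X'.d = X.d) : X'.e < X.e := by
  have hd := X.d_pos he
  obtain ⟨n₀, hn₀, U₀, x, hx, hxn, hx0⟩ := X.e_lt_top_iff.mp he
  have hU₀ := X.nonempty_of_ne_zero hx0
  obtain ⟨hdr, U, hU, hUU₀, c, s, hs⟩ := X.exists_isSlice hd U₀ hU₀
  have hj : ((r : ℤ) - ((X.d : ℤ) - 1)).toNat = Fintype.card (Fin (r - X.d)) + 1 := by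
    rw [Fintype.card_fin]; omega
  let : Algebra ℚ Γ(X.S, U.1) := ((scalar X.str U.1).comp (algebraMap ℚ k)).toAlgebra
  let : Algebra ℚ Γ(X.C, X.π ⁻¹ᵁ U.1) :=
    ((scalar (X.π ≫ X.str) _).comp (algebraMap ℚ k)).toAlgebra
  obtain ⟨n, hn, f, hf, hfJ, i, hi⟩ := hs.exists_transverse_ne_zero hw (X.isHomogeneous U)
    (fun f hf i => X.transverse_eq_zero hs (by simp; omega) hf i) hj
    (GaCoaction.map_mem_fittingIdeal (X.coaction_res U₀ U hUU₀) hx)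
    (X.res_mem U₀ U hUU₀ n₀ x hxn)
    ((map_ne_zero_iff _ (X.preimageRes_injective hUU₀ hU)).mpr hx0)
  obtain ⟨U', hU', hle⟩ := M.exists_affineOpen_le hU
  have h := M.preimage_le hle
  have := X'.isDomain U' hU'
  have hP : (irrelevant (X'.𝒜 U')).toIdeal.IsPrime := isPrime_irrelevant
  let hA := X'.isAffineOpen_preimage U'
  -- The generic point of the zero section of C'. Its local ring is the localisation at the
  -- irrelevant ideal, so denominators have non-zero degree-zero part.
  let y : PrimeSpectrum Γ(X'.C, X'.π ⁻¹ᵁ U'.1) := ⟨_, hP⟩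
  have hy : hA.fromSpec y ∈ X'.π ⁻¹ᵁ U'.1 := (hA.isoSpec.inv y).2
  obtain ⟨γ, hγ, hJ⟩ := M.exists_map_germ_eq_span U _ h (hA.fromSpec y) hy
  rw [X.centre_eq] at hJ
  let := X'.C.presheaf.algebra_section_stalk ⟨hA.fromSpec y, hy⟩
  have hloc : IsLocalization y.asIdeal.primeCompl (X'.C.presheaf.stalk (hA.fromSpec y)) :=
    hA.isLocalization_stalk' y hy
  obtain ⟨n', hn', g, hg, hgn, hg0⟩ := hs.exists_fittingIdeal_degree_lt
    (M.map_coaction U U' h hle) hw (X.isHomogeneous U) (X'.isHomogeneous U')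
    (M.map_mem U U' h hle) (M.appLE_injective hU' h) hj
    (X'.C.presheaf.germ _ _ hy).hom
    (germ_injective_of_isIntegral X'.C _ hy)
    (fun o => by
      obtain ⟨⟨t, b⟩, hb⟩ := IsLocalization.surj y.asIdeal.primeCompl o
      exact ⟨b.1, b.2, t, by rw [mul_comm]; exact hb⟩)
    hγ hJ hf hfJ hi
  have h1 : X'.e ≤ n' := by
    refine sInf_le ⟨n', ⟨U', g, ?_, hgn, hg0⟩, rfl⟩
    -- The Fitting index in `e` depends on `d`; equality of the two values makes the Fitting ideals
    -- correspond.
    rw [hdd]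
    exact hg
  rw [hn₀]
  refine h1.trans_lt ?_
  exact_mod_cast hn'.trans_le hn

end GradedCone

theorem proposition5p2 {k : Type u} [Field k] [IsAlgClosed k] [CharZero k] {r w : ℕ}
    (hw : 0 < w) (X : GradedCone k r w)
    (hd : ∀ z ∈ X.zeroSection, Module.finrank k (X.stab z) = X.d) (he : X.e < ⊤)
    (X' : GradedCone k r w) (M : X.Modification X.centre X') :
    X'.index < X.index := by
  rw [GradedCone.index, GradedCone.index, Prod.Lex.toLex_lt_toLex]
  rcases (M.d_le hd).lt_or_eq with hlt | heq
  · exact Or.inl hlt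
  · exact Or.inr ⟨heq, M.e_lt hw he heq⟩

end
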